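/- Let $p$ be an odd prime and $q=p^s$ with $s=2er=2\ell t$ for positive integers $e,r,\ell,t$, where $r$ is odd and $t$ is even. Set $\sqrt q=p^{er}$, $N=p^\ell+1$ and $d_0=\gcd\left(\frac N2,\frac{\sqrt q-1}{p^e-1}\right)$. The symplectic polar space $W(2r-1,p^e)$ is given by a $2r$-dimensional $\mathbb F_{p^e}$-vector space $V$ with a non-degenerate alternating form $f$; its points are the one-dimensional subspaces of $V$, its maximals are the totally isotropic subspaces of maximum dimension, and an $m$-ovoid is a set of points that meets every maximal in exactly $m$ points. We say that a set $\mathcal M$ of points of $(V,f)$ comes from field reduction if there are an extension field $E$ of $\mathbb F_{p^e}$, an $E$-vector space $W$ of dimension $2r'$ with $r'<r$, a non-degenerate alternating $E$-bilinear form $g$ on $W$, an $\mathbb F_{p^e}$-linear bijection $\varphi:W\to V$ with $f(\varphi x,\varphi y)=\mathrm{Tr}_{E/\mathbb F_{p^e}}(g(x,y))$ for all $x,y\in W$, and an $m'$-ovoid $\mathcal M'$ of $(W,g)$ for some $m'$, such that $\mathcal M=\{\langle\varphi(w)\rangle_{\mathbb F_{p^e}} : 0\ne w\in W,\ \langle w\rangle_E\in\mathcal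 M'\}$. 1. If $d_0>1$, then for every integer $1\le b\le d_0-1$ every model $(V,f)$ of $W(2r-1,p^e)$ contains a $\frac{b(\sqrt q-1)}{d_0(p^e-1)}$-ovoid (in particular, this number is an integer); if $r$ is prime, there is one that does not come from field reduction. 2. Let $\gamma$ be a primitive element of $\mathbb F_q$ and $\delta=\gamma^{(\sqrt q+1)/2}$. Then $f(x,y)=\mathrm{Tr}_{q/p^e}(\delta x y^{\sqrt q})$ is a non-degenerate alternating form on the $2r$-dimensional $\mathbb F_{p^e}$-space $\mathbb F_q$. If $d_0>1$, then for this model and every $1\le b\le d_0-1$ there is a $\frac{b(\sqrt q-1)}{d_0(p^e-1)}$-ovoid $\mathcal M$ such that $\{x\in\mathbb F_q^*:\langle x\rangle\in\mathcal M\}$ is a union of cyclotomic classes $C_i=\{\gamma^{jN+i}:0\le j\le\frac{q-1}N-1\}$, $0\le i\le N-1$, and such that, if $r$ is prime, $\mathcal M$ does not come from field reduction. 3. Suppose that $r$ is an odd prime. (A) If $r\mid t$, then $d_0=\gcd(N,r)$; hence $d_0>1$ if and only if $r\mid p^\ell+1$, and if and only if $d_0=r$. (B) If $r\nmid t$, then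 $d_0>1$. -/

import Mathlib

open scoped LinearAlgebra.Projectivization

universe u v

noncomputable section

namespace SymplecticPolar

section PolarSpace

variable {F : Type u} [Field F] {V : Type v} [AddCommGroup V] [Module F V]

/-- `U` is totally isotropic for the form `f`. -/
def IsTotallyIsotropic (f : LinearMap.BilinForm F V) (U : Submodule F V) : Prop :=
  ∀ x ∈ U, ∀ y ∈ U, f x y = 0

/-- A maximal (generator) of the polar space of `f`: a totally isotropic subspace of maximum
dimension. -/
def IsMaximal (f : LinearMap.BilinForm F V) (U : Submodule F V) : Prop :=
  IsTotallyIsotropic f U ∧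
    ∀ U' : Submodule F V, IsTotallyIsotropic f U' → Module.finrank F U' ≤ Module.finrank F U

/-- `f` makes `V` a model of the symplectic polar space of rank `r` over `F`, that is, `f` is a
non-degenerate alternating form on the `2r`-dimensional space `V`. All points of the projective
space of `V` are then points of the polar space. -/
def IsSymplecticSpace (r : ℕ) (f : LinearMap.BilinForm F V) : Prop :=
  Module.finrank F V = 2 * r ∧ f.IsAlt ∧ f.Nondegenerate

/-- `M` is an `m`-ovoid: each maximal contains exactly `m` points of `M` (all spaces to which this
is applied are finite). -/
def IsMOvoid (f : LinearMap.BilinForm F V) (m : ℕ) (M : Set (ℙ F V)) : Prop :=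
  ∀ U : Submodule F V, IsMaximal f U → {P : ℙ F V | P ∈ M ∧ P.submodule ≤ U}.ncard = m

/-- The points of the projective space over the small field `F` that lie on the members of a set
`M'` of points over the larger field `E`. The `F`-space underlying the `E`-space `W` is identified
with `V` through `φ`. -/
def fieldReduce {E : Type u} [Field E] {W : Type v} [AddCommGroup W] [Module E W] [Module F W]
    (φ : W ≃ₗ[F] V) (M' : Set (ℙ E W)) : Set (ℙ F V) :=
  {P | ∃ (w : W) (hw : w ≠ 0),
    Projectivization.mk E w hw ∈ M' ∧
      P = Projectivization.mk F (φ w) (φ.map_ne_zero_iff.mpr hw)}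

/-- The set of points `M` of the rank `r` symplectic polar space `(V, f)` comes by field reduction
from an `m'`-ovoid of a symplectic polar space `(W, g)` of smaller rank `r'` over an extension field
`E` of `F`, where `f` is the trace of `g`. (A scalar multiple of `g` is again a symplectic form, so
this also covers forms `x, y ↦ Tr (c * g x y)`, `c ≠ 0`.) -/
def ComesFromFieldReduction (r : ℕ) (f : LinearMap.BilinForm F V) (M : Set (ℙ F V)) : Prop :=
  ∃ (E : Type u) (_ : Field E) (_ : Algebra F E)
    (W : Type v) (_ : AddCommGroup W) (_ : Module E W) (_ : Module F W) (_ : IsScalarTower F E W)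
    (g : LinearMap.BilinForm E W) (r' m' : ℕ) (M' : Set (ℙ E W)) (φ : W ≃ₗ[F] V),
    r' < r ∧ IsSymplecticSpace r' g ∧ IsMOvoid g m' M' ∧
      (∀ x y : W, f (φ x) (φ y) = Algebra.trace F E (g x y)) ∧ M = fieldReduce φ M'

end PolarSpace

section Cyclotomy

/-- The cyclotomic class `C_i = {γ ^ (j N + i) | 0 ≤ j ≤ (q - 1) / N - 1}` of order `N` of the
finite field `K` with `q` elements. -/
def cyclotomicClass {K : Type v} [Field K] (γ : Kˣ) (N i : ℕ) : Set K :=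
  {x | ∃ j : ℕ, j < (Nat.card K - 1) / N ∧ x = (γ : K) ^ (j * N + i)}

/-- The union `D_J` of the cyclotomic classes of order `N` with index in `J`. -/
def cyclotomicUnion {K : Type v} [Field K] (γ : Kˣ) (N : ℕ) (J : Set (Fin N)) : Set K :=
  ⋃ i ∈ J, cyclotomicClass γ N (i : ℕ)

/-- The bilinear form `f(x, y) = Tr_{K/F}(x L(y))` with `L(y) = δ y ^ (|F| ^ r)`. -/
def modelForm (F : Type u) [Field F] [Fintype F] {K : Type v} [Field K] [Algebra F K]
    (r : ℕ) (δ : K) : LinearMap.BilinForm F K :=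
  (Algebra.traceForm F K).compl₂
    ((LinearMap.mulLeft F δ).comp ((FiniteField.frobeniusAlgHom F K) ^ r).toLinearMap)

theorem modelForm_apply (F : Type u) [Field F] [Fintype F] {K : Type v} [Field K] [Algebra F K]
    (r : ℕ) (δ x y : K) :
    modelForm F r δ x y = Algebra.trace F K (x * (δ * y ^ (Fintype.card F ^ r))) := by
  simp [modelForm, Algebra.traceForm_apply, AlgHom.coe_pow, FiniteField.coe_frobeniusAlgHom,
    pow_iterate]

end Cyclotomy

/-- `d₀ = gcd (N / 2, (√q - 1) / (p ^ e - 1))` with `N = p ^ ℓ + 1` and `√q = p ^ (e r)`; both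
quotients are exact for `p` odd and `e` positive. -/
def d₀ (p e r ℓ : ℕ) : ℕ :=
  Nat.gcd ((p ^ ℓ + 1) / 2) ((p ^ (e * r) - 1) / (p ^ e - 1))

end SymplecticPolar

end

universe w

namespace SymplecticPolar

/-! ### Arithmetic of `d₀`. -/

section Arithmetic

/-! Write R = √q, N = p^ℓ + 1, d = `d₀`. Since t is even, N divides R - 1, and the sums S(a) = ∑ ψ(a
x^N) over the field of order q take only two values for a ≠ 0: S(a) = R if a is not an N-th power,
and S(a) = R - N R if it is (`powerSum_of_notMem`, `powerSum_of_mem`). Hence a union D of cosets of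
the N-th powers has explicit character sums. If D is also stable under x ↦ (γ x)⁻¹, the sum of ψ(δ a
x^R) over x in D depends only on whether a lies in D (`sum_addChar_mul_pow`).

A maximal U is its own orthogonal space and has R vectors. Summing the character of f(u, x) over u
in U and x in D in both orders gives (R + 1) |D ∩ U| = |D| (`succ_mul_card_filter_isMaximal`), so D
yields an m-ovoid once it is closed under nonzero scalars of the small field.

D is cut out by a condition on discrete logarithms modulo 2d (`symmetricIndex`). Since 2d divides N,
D is a union of cyclotomic classes; since 2d divides (q - 1)/(p^e - 1), it is closed under scalars.
The reflection n ↦ -1 - n of exponents is x ↦ (γ x)⁻¹. Choosing b reflected pairs of residues gives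
|D| = b (q - 1)/d.

Any other model is isometric to the trace model (`exists_isometry`). For r prime, field reduction
could only start from rank 1, where the maximals are points and an m'-ovoid is empty or everything;
D is neither. -/

theorem div_eq_geom_sum {Q r : ℕ} (hQ : 2 ≤ Q) :
    (Q ^ r - 1) / (Q - 1) = ∑ i ∈ Finset.range r, Q ^ i :=
  (Nat.geomSum_eq hQ r).symm

theorem d₀_eq {p e : ℕ} (hp : 2 ≤ p) (he : 0 < e) (r ℓ : ℕ) :
    d₀ p e r ℓ = Nat.gcd ((p ^ ℓ + 1) / 2) (∑ i ∈ Finset.range r, (p ^ e) ^ i) := by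
  rw [d₀, pow_mul, div_eq_geom_sum (hp.trans (Nat.le_self_pow he.ne' p))]

theorem two_mul_d₀_dvd {p : ℕ} (hp : Odd p) (e r ℓ : ℕ) : 2 * d₀ p e r ℓ ∣ p ^ ℓ + 1 := by
  have h2 : 2 ∣ p ^ ℓ + 1 := (hp.pow.add_odd odd_one).two_dvd
  conv_rhs => rw [← Nat.mul_div_cancel' h2]
  exact Nat.mul_dvd_mul_left 2 (Nat.gcd_dvd_left _ _)

theorem succ_dvd_pow_sub_one (u : ℕ) {t : ℕ} (ht : Even t) : u + 1 ∣ u ^ t - 1 := by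
  obtain ⟨k, rfl⟩ := ht
  have h1 : u ^ 2 - 1 ∣ u ^ (k + k) - 1 := by
    rw [← two_mul, pow_mul]
    simpa using Nat.sub_dvd_pow_sub_pow (u ^ 2) 1 k
  refine Dvd.dvd.trans ?_ h1
  have := Nat.sq_sub_sq u 1
  rw [one_pow] at this
  exact this ▸ dvd_mul_right _ _

/-- Here e is an even multiple of ℓ, so p^e ≡ 1 modulo p^ℓ + 1 and the geometric sum is r modulo
N/2. Halving N does not change the gcd because r is odd. -/
theorem d₀_eq_gcd {p e r ℓ t : ℕ} (hp : 2 ≤ p) (hpo : Odd p) (he : 0 < e) (hr : 0 < r)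
    (h : e * r = ℓ * t) (hro : Odd r) (ht : Even t) (hrt : r ∣ t) :
    d₀ p e r ℓ = Nat.gcd (p ^ ℓ + 1) r := by
  obtain ⟨k, rfl⟩ := hrt
  have hk : Even k := by
    rcases Nat.even_mul.1 ht with h' | h'
    · exact absurd hro (Nat.not_odd_iff_even.2 h')
    · exact h'
  have hek : e = ℓ * k := Nat.eq_of_mul_eq_mul_right hr (by rw [h]; ring)
  have hN : p ^ ℓ + 1 ∣ p ^ e - 1 := by
    rw [hek, pow_mul]; exact succ_dvd_pow_sub_one _ hk
  have hN2 : 2 ∣ p ^ ℓ + 1 := (hpo.pow.add_odd odd_one).two_dvd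
  have hQ : p ^ e ≡ 1 [MOD (p ^ ℓ + 1) / 2] :=
    ((Nat.modEq_iff_dvd' (Nat.one_le_pow _ _ (by omega))).2
      ((Nat.div_dvd_of_dvd hN2).trans hN)).symm
  have hsum : ∑ i ∈ Finset.range r, (p ^ e) ^ i ≡ r [MOD (p ^ ℓ + 1) / 2] := by
    have := Nat.ModEq.sum (s := Finset.range r) (f := fun i => (p ^ e) ^ i) (g := fun _ => 1)
      (n := (p ^ ℓ + 1) / 2) fun i _ => by simpa using hQ.pow i
    simpa using this
  rw [d₀_eq hp he, Nat.gcd_comm, hsum.gcd_eq, Nat.gcd_comm]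
  conv_rhs => rw [← Nat.mul_div_cancel' hN2]
  exact (Nat.Coprime.gcd_mul_left_cancel _ (Nat.coprime_two_left.2 hro)).symm

/-- As r ∤ t forces ℓ = r l and e = l t, put u = p^l, so that N = u^r + 1. Any prime w dividing B =
(u^r + 1)/(u + 1) divides both N/2 and the geometric sum of powers of u^t. -/
theorem one_lt_d₀ {p e r ℓ t : ℕ} (hp : 2 ≤ p) (hpo : Odd p) (he : 0 < e) (hℓ : 0 < ℓ)
    (h : e * r = ℓ * t) (hr : r.Prime) (hro : Odd r) (ht : Even t) (hrt : ¬ r ∣ t) :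
    1 < d₀ p e r ℓ := by
  obtain ⟨l, rfl⟩ : r ∣ ℓ :=
    (hr.dvd_mul.1 (h ▸ dvd_mul_left r e : r ∣ ℓ * t)).resolve_right hrt
  have hel : e = l * t := Nat.eq_of_mul_eq_mul_right hr.pos (by rw [h]; ring)
  have hl : 0 < l := Nat.pos_of_mul_pos_left hℓ
  set u := p ^ l with hu
  have hu2 : 2 ≤ u := hp.trans (Nat.le_self_pow hl.ne' p)
  set B : ℤ := ∑ i ∈ Finset.range r, (-(u : ℤ)) ^ i with hB
  have hBu : B * (u + 1) = u ^ r + 1 := by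
    have := geom_sum_mul (-(u : ℤ)) r
    rw [hro.neg_pow] at this
    rw [hB]; linarith
  have hB1 : B.natAbs ≠ 1 := by
    intro h1
    have hlt : u ^ 1 < u ^ r := Nat.pow_lt_pow_right (by omega) hr.one_lt
    have hlt' : (u : ℤ) < u ^ r := by exact_mod_cast (pow_one u ▸ hlt)
    rcases Int.natAbs_eq B with h2 | h2 <;> rw [h2, h1] at hBu <;> push_cast at hBu <;> linarith
  obtain ⟨w, hw, hwB⟩ := Nat.exists_prime_and_dvd hB1
  have : Fact w.Prime := ⟨hw⟩
  have hwB' : ((∑ i ∈ Finset.range r, (-(u : ZMod w)) ^ i : ZMod w)) = 0 := by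
    have := (ZMod.intCast_zmod_eq_zero_iff_dvd B w).2 (Int.natCast_dvd.2 hwB)
    simpa [hB] using this
  have hur : (u : ZMod w) ^ r = -1 := by
    have := congrArg (Int.cast : ℤ → ZMod w) hBu
    simp only [hB] at this
    push_cast at this
    rw [hwB', zero_mul] at this
    exact (neg_eq_of_add_eq_zero_left this.symm).symm
  have hneg : (u : ZMod w) = -1 → w = r := by
    intro h1
    rw [h1] at hwB'
    simp only [neg_neg, one_pow, Finset.sum_const, Finset.card_range, nsmul_eq_mul, mul_one]
      at hwB'
    exact (Nat.prime_dvd_prime_iff_eq hw hr).1 ((ZMod.natCast_eq_zero_iff r w).1 hwB')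
  have hw2 : w ≠ 2 := by
    rintro rfl
    have huo : Odd u := hpo.pow
    have h1 : (u : ZMod 2) = 1 := ZMod.natCast_eq_one_iff_odd.2 huo
    have h2 := hneg (h1.trans (ZMod.neg_eq_self_mod_two 1).symm)
    rw [← h2] at hro
    exact absurd hro (by decide)
  have hwN : w ∣ (p ^ (r * l) + 1) / 2 := by
    have h1 : w ∣ p ^ (r * l) + 1 := by
      rw [← ZMod.natCast_eq_zero_iff, mul_comm r l, pow_mul, ← hu]
      push_cast
      rw [hur]; ring
    have hN2 : 2 ∣ p ^ (r * l) + 1 := (hpo.pow.add_odd odd_one).two_dvd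
    rw [← Nat.mul_div_cancel' hN2] at h1
    exact ((Nat.coprime_primes hw Nat.prime_two).2 hw2).dvd_of_dvd_mul_left h1
  have hwA : w ∣ ∑ i ∈ Finset.range r, (p ^ e) ^ i := by
    rw [← ZMod.natCast_eq_zero_iff, hel, pow_mul, ← hu]
    push_cast
    -- If u^t = 1 modulo w, then u² = 1 and hence u = -1, which forces w = r, and the sum of r ones
    -- vanishes. Otherwise u^t - 1 can be cancelled from u^(tr) - 1 = 0.
    by_cases h1 : (u : ZMod w) ^ t = 1
    · have hord : orderOf (u : ZMod w) ∣ Nat.gcd (2 * r) t := by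
        refine Nat.dvd_gcd (orderOf_dvd_of_pow_eq_one ?_) (orderOf_dvd_of_pow_eq_one h1)
        rw [mul_comm, pow_mul, hur]; ring
      have hg : Nat.gcd (2 * r) t = 2 := by
        rw [Nat.Coprime.gcd_mul_right_cancel _ ((Nat.Prime.coprime_iff_not_dvd hr).2 hrt)]
        exact Nat.gcd_eq_left ht.two_dvd
      rw [hg, orderOf_dvd_iff_pow_eq_one] at hord
      have hu1 : (u : ZMod w) = -1 := by
        obtain ⟨k, hk⟩ := hro
        rw [← hur, hk, pow_succ, pow_mul, hord, one_pow, one_mul]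
      have hwr := hneg hu1
      simp [h1, ← hwr]
    · have h2 := geom_sum_mul ((u : ZMod w) ^ t) r
      rw [← pow_mul, mul_comm t r, pow_mul, hur, ht.neg_one_pow, sub_self] at h2
      exact (mul_eq_zero.1 h2).resolve_right (sub_ne_zero.2 h1)
  rw [d₀_eq hp he]
  have hgpos : 0 < Nat.gcd ((p ^ (r * l) + 1) / 2) (∑ i ∈ Finset.range r, (p ^ e) ^ i) := by
    refine Nat.gcd_pos_of_pos_left _ (Nat.div_pos ?_ two_pos)
    have := Nat.one_le_pow (r * l) p (by omega)
    omega
  exact hw.one_lt.trans_le (Nat.le_of_dvd hgpos (Nat.dvd_gcd hwN hwA))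

end Arithmetic

/-! ### Uniqueness of the symplectic space of given dimension. -/

section Isometry

variable {F : Type u} [Field F] {V : Type v} [AddCommGroup V] [Module F V]

/-- A hyperbolic pair x, y spans a non-degenerate plane, whose orthogonal complement U splits off.
-/
theorem exists_hyperbolic_splitting [FiniteDimensional F V] [Nontrivial V]
    {f : LinearMap.BilinForm F V} (hf : f.IsAlt) (hn : f.Nondegenerate) :
    ∃ (U : Submodule F V) (e : ((F × F) × U) ≃ₗ[F] V),
      (f.restrict U).Nondegenerate ∧ ∀ z z', f (e z) (e z') =
        z.1.1 * z'.1.2 - z.1.2 * z'.1.1 + f.restrict U z.2 z'.2 := by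
  obtain ⟨x, hx⟩ := exists_ne (0 : V)
  obtain ⟨y, hxy⟩ : ∃ y, f x y = 1 := by
    by_contra! hcon
    refine hx (hn.1 x fun y => ?_)
    by_contra hy
    exact hcon ((f x y)⁻¹ • y) (by simp [hy])
  have hyx : f y x = -1 := by rw [← hf.neg_eq, hxy]
  have hxx := hf.self_eq_zero x
  have hyy := hf.self_eq_zero y
  let U : Submodule F V := LinearMap.ker (f x) ⊓ LinearMap.ker (f y)
  have hxU : ∀ z : U, f x z = 0 := fun z => z.2.1
  have hyU : ∀ z : U, f y z = 0 := fun z => z.2.2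
  have hUx : ∀ z : U, f z x = 0 := fun z => by rw [← hf.neg_eq, hxU, neg_zero]
  have hUy : ∀ z : U, f z y = 0 := fun z => by rw [← hf.neg_eq, hyU, neg_zero]
  let g : ((F × F) × U) →ₗ[F] V :=
    ((LinearMap.toSpanSingleton F V x).coprod (LinearMap.toSpanSingleton F V y)).coprod U.subtype
  have hg : ∀ z, g z = z.1.1 • x + z.1.2 • y + (z.2 : V) := fun z => by simp [g]
  have hinj : Function.Injective g := by
    refine LinearMap.ker_eq_bot.1 (LinearMap.ker_eq_bot'.2 fun z hz => ?_)
    rw [hg] at hz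
    have h1 := congrArg (f x) hz
    have h2 := congrArg (f y) hz
    simp [hxy, hyx, hxx, hyy, hxU, hyU] at h1 h2
    simp [h1, h2] at hz
    exact Prod.ext (Prod.ext h2 h1) hz
  have hdec : Function.Surjective g := fun v => by
    refine ⟨((-f y v, f x v), ⟨v + f y v • x - f x v • y, ?_⟩), ?_⟩
    · refine ⟨?_, ?_⟩ <;> simp [hxy, hyx, hxx, hyy]
    · rw [hg]; simp only [neg_smul]; abel
  have hbij : Function.Bijective g := ⟨hinj, hdec⟩
  refine ⟨U, LinearEquiv.ofBijective g hbij, ?_, fun z z' => ?_⟩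
  · have hleft : ∀ z : U, (∀ z' : U, f z z' = 0) → z = 0 := fun z hz => by
      refine Subtype.ext (hn.1 _ fun v => ?_)
      obtain ⟨z', rfl⟩ := hdec v
      simp [hg, hUx, hUy, hz]
    refine ⟨hleft, fun z hz => hleft z fun z' => ?_⟩
    rw [← hf.neg_eq, neg_eq_zero]
    exact hz z'
  · simp only [LinearEquiv.ofBijective_apply, hg]
    simp [hxy, hyx, hxx, hyy, hxU, hyU, hUx, hUy]
    ring

theorem exists_isometry {F : Type*} [Field F] (n : ℕ) :
    ∀ {V : Type*} [AddCommGroup V] [Module F V] {W : Type*} [AddCommGroup W] [Module F W]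
    [FiniteDimensional F V] [FiniteDimensional F W]
    {f : LinearMap.BilinForm F V} {g : LinearMap.BilinForm F W}, f.IsAlt → f.Nondegenerate →
    g.IsAlt → g.Nondegenerate → Module.finrank F V = n → Module.finrank F W = n →
    ∃ φ : V ≃ₗ[F] W, ∀ x y, g (φ x) (φ y) = f x y := by
  induction n using Nat.strong_induction_on with
  | _ n ih =>
  intro V _ _ W _ _ _ _ f g hf hf' hg hg' hV hW
  rcases Nat.eq_zero_or_pos n with rfl | hn
  · have := Module.finrank_zero_iff.1 hV
    have := Module.finrank_zero_iff.1 hW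
    exact ⟨LinearEquiv.ofFinrankEq _ _ (hV.trans hW.symm), fun x y => by
      rw [Subsingleton.elim x 0]; simp⟩
  have : Nontrivial V := Module.nontrivial_of_finrank_pos (hV ▸ hn)
  have : Nontrivial W := Module.nontrivial_of_finrank_pos (hW ▸ hn)
  obtain ⟨U, e, hU, he⟩ := exists_hyperbolic_splitting hf hf'
  obtain ⟨U', e', hU', he'⟩ := exists_hyperbolic_splitting hg hg'
  have h1 := e.finrank_eq
  have h2 := e'.finrank_eq
  simp only [Module.finrank_prod, Module.finrank_self, hV, hW] at h1 h2
  obtain ⟨ψ, hψ⟩ := ih (Module.finrank F U) (by omega) (f := f.restrict U) (g := g.restrict U')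
    (fun x => hf x) hU (fun x => hg x) hU' rfl (by omega)
  refine ⟨e.symm ≪≫ₗ (LinearEquiv.refl F _).prodCongr ψ ≪≫ₗ e', fun x y => ?_⟩
  obtain ⟨x, rfl⟩ := e.surjective x
  obtain ⟨y, rfl⟩ := e.surjective y
  simpa [he, he'] using hψ x.2 y.2

end Isometry

/-! ### Field reduction in prime rank. -/

section FieldReduction

variable {F : Type u} [Field F] {V : Type v} [AddCommGroup V] [Module F V]

theorem eq_empty_or_univ_of_isMOvoid {E : Type*} [Field E] {W : Type*} [AddCommGroup W]
    [Module E W] {g : LinearMap.BilinForm E W} (hg : IsSymplecticSpace 1 g) {m : ℕ}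
    {M : Set (ℙ E W)} (hM : IsMOvoid g m M) : M = ∅ ∨ M = Set.univ := by
  obtain ⟨hd, halt, hnd⟩ := hg
  have : FiniteDimensional E W := Module.finite_of_finrank_pos (by omega)
  have hmax : ∀ P : ℙ E W, IsMaximal g P.submodule := fun P => by
    refine ⟨fun x hx y hy => ?_, fun U hU => ?_⟩
    · rw [P.submodule_eq, Submodule.mem_span_singleton] at hx hy
      obtain ⟨a, rfl⟩ := hx
      obtain ⟨b, rfl⟩ := hy
      simp [halt.self_eq_zero]
    · rw [P.finrank_submodule]
      by_contra! hlt
      have htop : U = ⊤ := Submodule.eq_top_of_finrank_eq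
        (le_antisymm (Submodule.finrank_le U) (by omega))
      have : Nontrivial W := Module.nontrivial_of_finrank_pos (R := E) (by omega)
      obtain ⟨x, hx⟩ := exists_ne (0 : W)
      exact hx (hnd.1 x fun y => hU x (htop ▸ trivial) y (htop ▸ trivial))
  have hle : ∀ P Q : ℙ E W, Q.submodule ≤ P.submodule → Q = P := fun P Q h =>
    Projectivization.submodule_injective
      (Submodule.eq_of_le_of_finrank_eq h (by rw [P.finrank_submodule, Q.finrank_submodule]))
  have hcount : ∀ P : ℙ E W, (P ∈ M → m = 1) ∧ (P ∉ M → m = 0) := fun P => by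
    have h := hM _ (hmax P)
    refine ⟨fun hP => ?_, fun hP => ?_⟩
    · rw [← h, Set.ncard_eq_one]
      refine ⟨P, Set.eq_singleton_iff_unique_mem.2 ⟨⟨hP, le_rfl⟩, fun Q hQ => hle P Q hQ.2⟩⟩
    · rw [← h]
      convert! Set.ncard_empty (ℙ E W)
      refine Set.eq_empty_of_forall_notMem fun Q hQ => hP (hle P Q hQ.2 ▸ hQ.1)
  by_contra! hcon
  obtain ⟨⟨P, hP⟩, h2⟩ := hcon
  obtain ⟨Q, hQ⟩ := (Set.ne_univ_iff_exists_notMem M).1 h2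
  have := (hcount P).1 hP
  have := (hcount Q).2 hQ
  omega

/-- Comparing dimensions gives [E : F] r' = r, so r' = 1, and then only the empty set and the full
point set arise. -/
theorem not_comesFromFieldReduction {r : ℕ} (hr : r.Prime) {f : LinearMap.BilinForm F V}
    (hf : IsSymplecticSpace r f) {M : Set (ℙ F V)} (hne : M.Nonempty) (hnu : M ≠ Set.univ) :
    ¬ ComesFromFieldReduction r f M := by
  rintro ⟨E, _, _, W, _, _, _, _, g, r', m', M', φ, hlt, hg, hM', -, rfl⟩
  have hdim : Module.finrank F E * Module.finrank E W = 2 * r := by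
    rw [Module.finrank_mul_finrank, φ.finrank_eq, hf.1]
  have hr' : r' = 1 := by
    have h1 : Module.finrank F E * r' = r := by
      rw [hg.1] at hdim
      exact Nat.eq_of_mul_eq_mul_left two_pos (by rw [← hdim]; ring)
    exact ((Nat.dvd_prime hr).1 (Dvd.intro_left _ h1)).resolve_right hlt.ne
  subst hr'
  rcases eq_empty_or_univ_of_isMOvoid hg hM' with rfl | rfl
  · obtain ⟨P, w, hw, h, -⟩ := hne
    exact h
  · refine hnu (Set.eq_univ_of_forall fun P => ?_)
    induction P using Projectivization.ind with
    | h v hv =>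
    exact ⟨φ.symm v, by simpa using hv, trivial, by simp⟩

end FieldReduction

/-! ### N-th powers in a finite cyclic group. -/

section CyclicPowers

variable {G : Type*} [CommGroup G] [IsCyclic G] [Fintype G] [DecidableEq G]

/-- The set of `N`-th powers. -/
def powers (G : Type*) [CommGroup G] [Fintype G] [DecidableEq G] (N : ℕ) : Finset G :=
  Finset.univ.image fun z : G => z ^ N

omit [IsCyclic G] in
theorem mem_powers {N : ℕ} {u : G} : u ∈ powers G N ↔ ∃ z, z ^ N = u := by
  simp [powers]

omit [IsCyclic G] in
theorem mul_pow_mem_powers {N : ℕ} {u z : G} : u * z ^ N ∈ powers G N ↔ u ∈ powers G N := by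
  rw [mem_powers, mem_powers]
  refine ⟨fun ⟨w, hw⟩ => ⟨w * z⁻¹, ?_⟩, fun ⟨w, hw⟩ => ⟨w * z, ?_⟩⟩
  · rw [mul_pow, hw, inv_pow, mul_inv_cancel_right]
  · rw [mul_pow, hw]

theorem mem_powers_of_pow_eq_one {N M : ℕ} (hM : 0 < M) (hG : N * M = Nat.card G) {u : G}
    (hu : u ^ M = 1) : u ∈ powers G N := by
  obtain ⟨g, hg⟩ := IsCyclic.exists_generator (α := G)
  obtain ⟨n, rfl⟩ := (mem_powers_iff_mem_zpowers (x := g)).2 (hg u)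
  simp only at hu
  rw [← pow_mul, ← orderOf_dvd_iff_pow_eq_one, orderOf_eq_card_of_forall_mem_zpowers hg, ← hG]
    at hu
  obtain ⟨k, rfl⟩ := Nat.dvd_of_mul_dvd_mul_right hM hu
  exact mem_powers.2 ⟨g ^ k, by rw [← pow_mul, mul_comm]⟩

theorem sum_comp_pow {A : Type*} [AddCommMonoid A] {N M : ℕ} (hG : N * M = Nat.card G)
    (g : G → A) : ∑ x : G, g (x ^ N) = N • ∑ h ∈ powers G N, g h := by
  rw [Finset.sum_comp g (fun x : G => x ^ N), Finset.smul_sum]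
  refine Finset.sum_congr rfl fun h hh => ?_
  congr 1
  have h1 := MonoidHom.card_fiber_eq_of_mem_range (powMonoidHom N : G →* G) (x := h) (y := 1)
    (by simpa [powers] using hh) ⟨1, by simp⟩
  simp only [powMonoidHom_apply] at h1
  rw [h1]
  have h2 := IsCyclic.card_powMonoidHom_ker G N
  rw [← hG, Nat.gcd_eq_right (dvd_mul_right _ _)] at h2
  refine Eq.trans ?_ h2
  rw [Nat.card_eq_fintype_card, Fintype.card_subtype]
  simp [MonoidHom.mem_ker]

theorem card_powers {N M : ℕ} (hN : 0 < N) (hG : N * M = Nat.card G) :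
    (powers G N).card = M := by
  have h := sum_comp_pow hG fun _ => (1 : ℕ)
  simp only [Finset.sum_const, Finset.card_univ, smul_eq_mul, mul_one] at h
  rw [← Nat.card_eq_fintype_card, ← hG] at h
  exact (Nat.eq_of_mul_eq_mul_left hN h).symm

end CyclicPowers

/-! ### The two values of the power sums. -/

section PowerSums

variable {K : Type*} [Field K] [Fintype K]

/-- The exponential sum `∑ x, ψ (a * x ^ N)`. -/
noncomputable def powerSum (ψ : AddChar K ℂ) (N : ℕ) (a : K) : ℂ := ∑ x : K, ψ (a * x ^ N)

theorem powerSum_zero (ψ : AddChar K ℂ) (N : ℕ) : powerSum ψ N 0 = Fintype.card K := by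
  simp [powerSum]

theorem powerSum_mul_pow (ψ : AddChar K ℂ) (N : ℕ) (a : K) {z : K} (hz : z ≠ 0) :
    powerSum ψ N (a * z ^ N) = powerSum ψ N a := by
  refine Fintype.sum_bijective _ (mulLeft_bijective₀ z hz) _ _ fun x => ?_
  rw [mul_pow, mul_assoc]

theorem sum_eq_zero_add_sum_units [DecidableEq K] (g : K → ℂ) :
    ∑ x, g x = g 0 + ∑ x : Kˣ, g x := by
  rw [Fintype.sum_eq_add_sum_compl 0]
  congr 1
  refine (Finset.sum_bij (fun (x : Kˣ) _ => (x : K)) (fun x _ => by simp)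
    (fun x _ y _ h => Units.ext h) (fun x hx => ?_) fun _ _ => rfl).symm
  exact ⟨Units.mk0 x (by simpa using hx), Finset.mem_univ _, rfl⟩

theorem powerSum_eq_one_add [DecidableEq K] (ψ : AddChar K ℂ) {N : ℕ} (hN : 0 < N) (a : K) :
    powerSum ψ N a = 1 + ∑ x : Kˣ, ψ (a * (x : K) ^ N) := by
  rw [powerSum, sum_eq_zero_add_sum_units]
  simp [hN.ne']

theorem sum_powerSum {ψ : AddChar K ℂ} (hψ : ψ.IsPrimitive) {N : ℕ} (hN : 0 < N) :
    ∑ a, powerSum ψ N a = Fintype.card K := by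
  classical
  simp only [powerSum]
  rw [Finset.sum_comm]
  simp only [AddChar.sum_mulShift _ hψ]
  simp [hN.ne']

variable {p : ℕ} [Fact p.Prime] [CharP K p]

omit [Fintype K] [Fact p.Prime] [CharP K p] in
theorem addChar_pow_char_pow {ψ : AddChar K ℂ} (hfrob : ∀ z, ψ (z ^ p) = ψ z) (k : ℕ) (z : K) :
    ψ (z ^ p ^ k) = ψ z := by
  induction k with
  | zero => simp
  | succ k ih => rw [pow_succ, pow_mul, hfrob, ih]

theorem bijective_pow_char_pow (k : ℕ) : Function.Bijective fun z : K => z ^ p ^ k := by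
  have := bijective_iterateFrobenius K p k
  simpa only [funext (iterateFrobenius_def p k)] using this

/-- With θ = p^ℓ, substitute y + x for the first variable. Frobenius invariance of ψ moves the term
a y^θ x to a multiple of x^θ, so the sum over x is a complete character sum with coefficient a y +
a^θ y^(θ²). Multiplied by y^θ, its vanishing is exactly the equation excluded by `h`; only y = 0
survives. -/
theorem powerSum_mul_powerSum_neg {ψ : AddChar K ℂ} (hψ : ψ.IsPrimitive)
    (hfrob : ∀ z, ψ (z ^ p) = ψ z) (ℓ : ℕ) {a : K}
    (h : ∀ y : K, (a * y ^ (p ^ ℓ + 1)) ^ p ^ ℓ = -(a * y ^ (p ^ ℓ + 1)) → y = 0) :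
    powerSum ψ (p ^ ℓ + 1) a * powerSum ψ (p ^ ℓ + 1) (-a) = Fintype.card K := by
  classical
  have hinner : ∀ y : K, ∑ x : K, ψ (a * (y + x) ^ (p ^ ℓ + 1)) * ψ (-a * x ^ (p ^ ℓ + 1)) =
      if y = 0 then (Fintype.card K : ℂ) else 0 := by
    intro y
    have h1 : ∀ x : K, ψ (a * (y + x) ^ (p ^ ℓ + 1)) * ψ (-a * x ^ (p ^ ℓ + 1)) =
        ψ (a * y ^ (p ^ ℓ + 1)) * ψ (x ^ p ^ ℓ * (a * y + a ^ p ^ ℓ * (y ^ p ^ ℓ) ^ p ^ ℓ)) := by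
      intro x
      rw [mul_add, AddChar.map_add_eq_mul]
      rw [show x ^ p ^ ℓ * (a ^ p ^ ℓ * (y ^ p ^ ℓ) ^ p ^ ℓ) = (x * a * y ^ p ^ ℓ) ^ p ^ ℓ by ring,
        addChar_pow_char_pow hfrob, ← AddChar.map_add_eq_mul, ← AddChar.map_add_eq_mul,
        ← AddChar.map_add_eq_mul]
      congr 1
      rw [pow_succ (y + x), add_pow_char_pow]
      ring
    simp_rw [h1, ← Finset.mul_sum]
    rw [(bijective_pow_char_pow (p := p) ℓ).sum_comp
      (fun x => ψ (x * (a * y + a ^ p ^ ℓ * (y ^ p ^ ℓ) ^ p ^ ℓ))), AddChar.sum_mulShift _ hψ]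
    by_cases hy : y = 0
    · have hp0 : p ≠ 0 := (Fact.out : p.Prime).ne_zero
      simp [hy, hp0]
    · rw [if_neg, if_neg hy]
      · simp
      · intro h0
        refine hy (h y ?_)
        linear_combination (y ^ p ^ ℓ) * h0
  rw [powerSum, powerSum, Finset.sum_mul_sum, Finset.sum_comm]
  have : ∀ x : K, ∑ i : K, ψ (a * i ^ (p ^ ℓ + 1)) * ψ (-a * x ^ (p ^ ℓ + 1)) =
      ∑ y : K, ψ (a * (y + x) ^ (p ^ ℓ + 1)) * ψ (-a * x ^ (p ^ ℓ + 1)) := fun x =>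
    (Equiv.sum_comp (Equiv.addRight x)
      (fun i => ψ (a * i ^ (p ^ ℓ + 1)) * ψ (-a * x ^ (p ^ ℓ + 1)))).symm
  simp_rw [this]
  rw [Finset.sum_comm]
  simp_rw [hinner]
  simp

theorem isIntegral_addChar (ψ : AddChar K ℂ) (x : K) : IsIntegral ℤ (ψ x) := by
  refine IsIntegral.of_pow (n := Fintype.card K) Fintype.card_pos ?_
  rw [← AddChar.map_nsmul_eq_pow, card_nsmul_eq_zero, AddChar.map_zero_eq_one]
  exact isIntegral_one

variable [DecidableEq K] {ψ : AddChar K ℂ} {ℓ M R : ℕ}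

/-- Since -1 is an N-th power, the previous product is S(a)² = R², and a congruence modulo N fixes
the sign. -/
theorem powerSum_of_notMem (hψ : ψ.IsPrimitive) (hfrob : ∀ z, ψ (z ^ p) = ψ z)
    (hp : 2 < p) (hℓ : 0 < ℓ) (hq : Fintype.card K = R ^ 2) (hR : p ^ ℓ + 1 ∣ R - 1) (hR0 : 0 < R)
    (hM : (p ^ ℓ + 1) * M = Fintype.card K - 1) (hM0 : 0 < M) (hM2 : 2 * (p ^ ℓ - 1) ∣ M)
    {a : Kˣ} (ha : a ∉ powers Kˣ (p ^ ℓ + 1)) : powerSum ψ (p ^ ℓ + 1) a = R := by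
  have hG : (p ^ ℓ + 1) * M = Nat.card Kˣ := by
    rw [hM, Nat.card_units, Nat.card_eq_fintype_card]
  have hθ : 2 < p ^ ℓ := hp.trans_le (Nat.le_self_pow hℓ.ne' p)
  have hneg : powerSum ψ (p ^ ℓ + 1) (-(a : K)) = powerSum ψ (p ^ ℓ + 1) a := by
    have hME : Even M := even_iff_two_dvd.2 ((dvd_mul_right _ _).trans hM2)
    obtain ⟨z, hz⟩ := mem_powers.1
      (mem_powers_of_pow_eq_one hM0 hG (u := (-1 : Kˣ)) hME.neg_one_pow)
    have hz' : (z : K) ^ (p ^ ℓ + 1) = -1 := by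
      have := congrArg Units.val hz
      simpa using this
    rw [← powerSum_mul_pow ψ _ (a : K) z.ne_zero, hz', mul_neg_one]
  -- A nonzero root gives w = a y^N with w^(θ - 1) = -1, so w^M = 1; then w, and with it a, would be
  -- an N-th power.
  have hmul := powerSum_mul_powerSum_neg hψ hfrob ℓ (a := (a : K)) (fun y hy => by
    by_contra hy0
    let w : Kˣ := a * Units.mk0 y hy0 ^ (p ^ ℓ + 1)
    have hw : w ^ p ^ ℓ = -w := Units.ext (by simpa [w] using hy)
    have hw1 : w ^ (p ^ ℓ - 1) = -1 := by
      have h1 : w ^ (p ^ ℓ - 1) * w = -1 * w := by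
        rw [← pow_succ, Nat.sub_add_cancel (by omega), hw, neg_one_mul]
      exact mul_right_cancel h1
    have hw2 : w ^ M = 1 := by
      obtain ⟨k, rfl⟩ := hM2
      rw [mul_comm 2, pow_mul, pow_mul, hw1]
      simp
    exact ha (mul_pow_mem_powers.1 (mem_powers_of_pow_eq_one hM0 hG hw2)))
  rw [hneg, hq] at hmul
  have hsq : (powerSum ψ (p ^ ℓ + 1) a - R) * (powerSum ψ (p ^ ℓ + 1) a + R) = 0 := by
    push_cast at hmul
    linear_combination hmul
  rcases mul_eq_zero.1 hsq with h | h
  · exact sub_eq_zero.1 h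
  exfalso
  -- S(a) = 1 + N Z with Z an algebraic integer. If S(a) = -R, then Z is rational, hence an integer,
  -- and R ≡ 1 modulo N leads to N ∣ 2.
  set Z : ℂ := ∑ x ∈ powers Kˣ (p ^ ℓ + 1), ψ (a * (x : K)) with hZ
  have hint : IsIntegral ℤ Z := IsIntegral.sum _ fun x _ => isIntegral_addChar ψ _
  have hS : powerSum ψ (p ^ ℓ + 1) a = 1 + (p ^ ℓ + 1 : ℕ) * Z := by
    rw [powerSum_eq_one_add _ (Nat.succ_pos _), hZ, ← nsmul_eq_mul,
      ← sum_comp_pow hG (fun x : Kˣ => ψ (a * (x : K)))]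
    simp
  have hN0 : ((p ^ ℓ + 1 : ℕ) : ℂ) ≠ 0 := Nat.cast_ne_zero.2 (Nat.succ_ne_zero _)
  have hrat : Z = ((-(R + 1) / (p ^ ℓ + 1 : ℕ) : ℚ) : ℂ) := by
    rw [hS] at h
    push_cast at h hN0 ⊢
    rw [eq_div_iff hN0]
    linear_combination h
  obtain ⟨k, hk⟩ := hint.exists_int_iff_exists_rat.1 ⟨_, hrat⟩
  rw [hS, hk] at h
  have hk' : 1 + (p ^ ℓ + 1 : ℕ) * k + R = (0 : ℤ) := by exact_mod_cast h
  have hd : ((p ^ ℓ + 1 : ℕ) : ℤ) ∣ 2 := by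
    obtain ⟨m, hm⟩ := hR
    have hm' : (R : ℤ) = 1 + (p ^ ℓ + 1 : ℕ) * m := by
      rw [← Nat.cast_mul, ← hm]; push_cast [hR0]; ring
    exact ⟨-(k + m), by rw [hm'] at hk'; linear_combination hk'⟩
  have := Nat.le_of_dvd two_pos (Int.natCast_dvd_natCast.1 hd)
  omega

/-- The sums S(a) over all a ≠ 0 add up to zero and S is constant on the N-th powers, so the value
off them determines the value on them. -/
theorem powerSum_of_mem (hψ : ψ.IsPrimitive) (hfrob : ∀ z, ψ (z ^ p) = ψ z)
    (hp : 2 < p) (hℓ : 0 < ℓ) (hq : Fintype.card K = R ^ 2) (hR : p ^ ℓ + 1 ∣ R - 1) (hR0 : 0 < R)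
    (hM : (p ^ ℓ + 1) * M = Fintype.card K - 1) (hM0 : 0 < M) (hM2 : 2 * (p ^ ℓ - 1) ∣ M)
    {a : Kˣ} (ha : a ∈ powers Kˣ (p ^ ℓ + 1)) :
    powerSum ψ (p ^ ℓ + 1) a = R - (p ^ ℓ + 1 : ℕ) * R := by
  have hG : (p ^ ℓ + 1) * M = Nat.card Kˣ := by
    rw [hM, Nat.card_units, Nat.card_eq_fintype_card]
  have hconst : ∀ b ∈ powers Kˣ (p ^ ℓ + 1),
      powerSum ψ (p ^ ℓ + 1) (b : K) = powerSum ψ (p ^ ℓ + 1) 1 := fun b hb => by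
    obtain ⟨z, rfl⟩ := mem_powers.1 hb
    rw [← powerSum_mul_pow ψ _ 1 z.ne_zero]
    simp
  have hsum := sum_powerSum hψ (Nat.succ_pos (p ^ ℓ))
  rw [sum_eq_zero_add_sum_units, powerSum_zero, add_eq_left,
    ← Finset.sum_add_sum_compl (powers Kˣ (p ^ ℓ + 1)), Finset.sum_congr rfl hconst,
    Finset.sum_congr rfl (fun b hb => powerSum_of_notMem hψ hfrob hp hℓ hq hR hR0 hM hM0 hM2
      (Finset.mem_compl.1 hb)), Finset.sum_const, Finset.sum_const, Finset.card_compl,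
    card_powers (Nat.succ_pos _) hG, ← Nat.card_eq_fintype_card, ← hG, nsmul_eq_mul, nsmul_eq_mul,
    Nat.cast_sub (Nat.le_mul_of_pos_left M (Nat.succ_pos _))] at hsum
  rw [hconst a ha]
  have hM' : (M : ℂ) ≠ 0 := Nat.cast_ne_zero.2 hM0.ne'
  refine mul_left_cancel₀ hM' ?_
  rw [Nat.cast_mul] at hsum
  linear_combination hsum

end PowerSums

/-! ### Character sums over unions of cosets. -/

section CharacterSum

variable {K : Type*} [Field K] [Fintype K] [DecidableEq K] {p : ℕ} [Fact p.Prime] [CharP K p]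
  {ψ : AddChar K ℂ} {ℓ M k : ℕ}

/-- Averaging over x ↦ x y^N, which preserves D, turns each term into a power sum; the factor q - 1
is the number of such y. As δ/γ and x^(R - 1) are N-th powers, δ a x^R is one exactly when γ a x is.
The x with this property form the coset of (γ a)⁻¹, which lies in D or misses it according to
whether a is in D. -/
theorem sum_addChar_mul_pow (hψ : ψ.IsPrimitive) (hfrob : ∀ z, ψ (z ^ p) = ψ z)
    (hp : 2 < p) (hℓ : 0 < ℓ) (hq : Fintype.card K = (p ^ k) ^ 2) (hR : p ^ ℓ + 1 ∣ p ^ k - 1)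
    (hM : (p ^ ℓ + 1) * M = Fintype.card K - 1) (hM0 : 0 < M) (hM2 : 2 * (p ^ ℓ - 1) ∣ M)
    {γ δ : Kˣ} (hδ : δ * γ⁻¹ ∈ powers Kˣ (p ^ ℓ + 1)) {D : Finset Kˣ}
    (hD : ∀ x z : Kˣ, x * z ^ (p ^ ℓ + 1) ∈ D ↔ x ∈ D)
    (hDinv : ∀ x : Kˣ, (γ * x)⁻¹ ∈ D ↔ x ∈ D) (a : Kˣ) :
    ((Fintype.card K : ℂ) - 1) * ∑ x ∈ D, ψ (δ * a * (x : K) ^ p ^ k) =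
      D.card * ((p ^ k : ℕ) - 1) -
        (p ^ k : ℕ) * ((Fintype.card K : ℂ) - 1) * if a ∈ D then 1 else 0 := by
  set N := p ^ ℓ + 1 with hN
  have hN0 : 0 < N := Nat.succ_pos _
  have hR0 : 0 < p ^ k := pow_pos (Fact.out : p.Prime).pos _
  have hG : N * M = Nat.card Kˣ := by rw [hM, Nat.card_units, Nat.card_eq_fintype_card]
  have hcard : (Fintype.card Kˣ : ℂ) = (Fintype.card K : ℂ) - 1 := by
    rw [Fintype.card_units, Nat.cast_sub Fintype.card_pos, Nat.cast_one]
  have hNM : (N : ℂ) * M = (Fintype.card K : ℂ) - 1 := by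
    rw [← hcard, ← Nat.card_eq_fintype_card, ← hG, Nat.cast_mul]
  have hshift : ∀ y : Kˣ, ∑ x ∈ D, ψ (δ * a * (x : K) ^ p ^ k) =
      ∑ x ∈ D, ψ (δ * a * (x : K) ^ p ^ k * ((y : K) ^ p ^ k) ^ N) := fun y => by
    refine (Finset.sum_bij (fun x _ => x * y ^ N) (fun x hx => (hD x y).2 hx)
      (fun x _ x' _ h => mul_right_cancel h) (fun x hx => ?_) fun x hx => ?_).symm
    · exact ⟨x * (y⁻¹) ^ N, (hD x _).2 hx, by simp⟩
    · congr 1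
      push_cast
      ring
  have hbij : Function.Bijective fun y : Kˣ => y ^ p ^ k := by
    refine Finite.injective_iff_bijective.1 fun x y h => Units.ext ?_
    exact (bijective_pow_char_pow (K := K) (p := p) k).1 (by simpa using congrArg Units.val h)
  have hmem : ∀ x : Kˣ, δ * a * x ^ p ^ k ∈ powers Kˣ N ↔ γ * a * x ∈ powers Kˣ N := fun x => by
    obtain ⟨z, hz⟩ := mem_powers.1 hδ
    obtain ⟨m, hm⟩ := hR
    have : δ * a * x ^ p ^ k = γ * a * x * (z * x ^ m) ^ N := by
      rw [mul_pow, hz, ← pow_mul, mul_comm m, ← hm]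
      conv_lhs => rw [← Nat.sub_add_cancel hR0, pow_succ]
      calc _ = (γ * γ⁻¹) * (δ * a * (x ^ (p ^ k - 1) * x)) := by rw [mul_inv_cancel, one_mul]
        _ = _ := by simp only [mul_assoc, mul_comm, mul_left_comm]
    rw [this, mul_pow_mem_powers]
  have hps : ∀ x : Kˣ, ∑ y : Kˣ, ψ (δ * a * (x : K) ^ p ^ k * ((y : K) ^ p ^ k) ^ N) =
      (p ^ k : ℕ) - 1 - N * (p ^ k : ℕ) * if γ * a * x ∈ powers Kˣ N then 1 else 0 := fun x => by
    have h1 := hbij.sum_comp (fun y : Kˣ => ψ (δ * a * (x : K) ^ p ^ k * (y : K) ^ N))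
    simp only [Units.val_pow_eq_pow_val] at h1
    rw [h1]
    have h2 := powerSum_eq_one_add ψ hN0 (((δ * a * x ^ p ^ k : Kˣ)) : K)
    by_cases h3 : γ * a * x ∈ powers Kˣ N
    · rw [powerSum_of_mem hψ hfrob hp hℓ hq hR hR0 hM hM0 hM2 ((hmem x).2 h3),
        ← hN] at h2
      rw [if_pos h3]
      push_cast at h2 ⊢
      linear_combination -h2
    · rw [powerSum_of_notMem hψ hfrob hp hℓ hq hR hR0 hM hM0 hM2 (mt (hmem x).1 h3)] at h2
      rw [if_neg h3]
      push_cast at h2 ⊢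
      linear_combination -h2
  have hcount : ((D.filter fun x => γ * a * x ∈ powers Kˣ N).card : ℂ) =
      M * if a ∈ D then 1 else 0 := by
    split_ifs with ha
    · rw [mul_one, ← card_powers hN0 hG]
      congr 1
      refine Finset.card_bij (fun x _ => γ * a * x) (fun x hx => (Finset.mem_filter.1 hx).2)
        (fun x _ y _ h => mul_left_cancel h) fun h hh => ?_
      refine ⟨(γ * a)⁻¹ * h, Finset.mem_filter.2 ⟨?_, ?_⟩, mul_inv_cancel_left _ _⟩
      · obtain ⟨z, rfl⟩ := mem_powers.1 hh
        rw [hD, hDinv]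
        exact ha
      · rwa [mul_inv_cancel_left]
    · rw [mul_zero, Nat.cast_eq_zero, Finset.card_eq_zero, Finset.filter_eq_empty_iff]
      intro x hx hh
      obtain ⟨z, hz⟩ := mem_powers.1 hh
      refine ha ((hDinv a).1 ((hD _ z).1 ?_))
      rwa [hz, inv_mul_cancel_left]
  calc ((Fintype.card K : ℂ) - 1) * ∑ x ∈ D, ψ (δ * a * (x : K) ^ p ^ k)
      = ∑ y : Kˣ, ∑ x ∈ D, ψ (δ * a * (x : K) ^ p ^ k * ((y : K) ^ p ^ k) ^ N) := by
        rw [← Finset.sum_congr rfl fun y _ => hshift y, Finset.sum_const, Finset.card_univ,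
          nsmul_eq_mul, hcard]
    _ = ∑ x ∈ D, ((p ^ k : ℕ) - 1 -
          N * (p ^ k : ℕ) * if γ * a * x ∈ powers Kˣ N then (1 : ℂ) else 0) := by
        rw [Finset.sum_comm]
        exact Finset.sum_congr rfl fun x _ => hps x
    _ = _ := by
        rw [Finset.sum_sub_distrib, Finset.sum_const, nsmul_eq_mul, ← Finset.mul_sum,
          Finset.sum_boole, hcount, ← hNM]
        ring

end CharacterSum

/-! ### Additive characters from traces. -/

section TraceCharacter

theorem exists_trace_mul_ne_zero (k : Type*) {L : Type*} [Field k] [Finite k] [Field L] [Finite L]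
    [Algebra k L] {a : L} (ha : a ≠ 0) : ∃ y, Algebra.trace k L (a * y) ≠ 0 := by
  by_contra! h
  exact ha ((traceForm_nondegenerate k L).1 a h)

theorem isPrimitive_comp_trace {k L : Type*} [Field k] [Finite k] [Field L] [Finite L]
    [Algebra k L] {χ : AddChar k ℂ} (hχ : χ.IsPrimitive) :
    (χ.compAddMonoidHom (Algebra.trace k L).toAddMonoidHom).IsPrimitive := by
  intro a ha
  obtain ⟨y, hy⟩ := exists_trace_mul_ne_zero k ha
  have h1 := hχ hy
  rw [AddChar.ne_one_iff] at h1 ⊢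
  obtain ⟨c, hc⟩ := h1
  refine ⟨c • y, ?_⟩
  simpa [mul_comm c] using hc

/-- Taking χ through the trace to the prime field makes its lift to K a function of the absolute
trace, which Frobenius fixes. -/
theorem exists_traceChar (F : Type*) [Field F] [Finite F] (K : Type*) [Field K] [Finite K]
    [Algebra F K] (p : ℕ) [Fact p.Prime] [CharP F p] [CharP K p] :
    ∃ χ : AddChar F ℂ, χ.IsPrimitive ∧
      ∀ z : K, χ (Algebra.trace F K (z ^ p)) = χ (Algebra.trace F K z) := by
  let := ZMod.algebra F p
  let := ZMod.algebra K p
  have : IsScalarTower (ZMod p) F K := .of_algebraMap_eq' (Subsingleton.elim _ _)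
  refine ⟨_, isPrimitive_comp_trace (ZMod.isPrimitive_stdAddChar p), fun z => ?_⟩
  simp only [AddChar.compAddMonoidHom_apply, LinearMap.toAddMonoidHom_coe]
  rw [Algebra.trace_trace, Algebra.trace_trace]
  congr 1
  have := Algebra.trace_eq_of_algEquiv
    (FiniteField.frobeniusAlgEquiv (ZMod p) K p) z
  simpa using this

end TraceCharacter

/-! ### Maximals and point counts. -/

section Ovoid

variable {F : Type u} [Field F] {V : Type v} [AddCommGroup V] [Module F V]

theorem IsMaximal.mem_of_forall [FiniteDimensional F V] {f : LinearMap.BilinForm F V}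
    (hf : f.IsAlt) {U : Submodule F V} (hU : IsMaximal f U) {v : V} (hv : ∀ u ∈ U, f u v = 0) :
    v ∈ U := by
  by_contra hvU
  have hv' : ∀ u ∈ U, f v u = 0 := fun u hu => by rw [← hf.neg_eq, hv u hu, neg_zero]
  have hiso : IsTotallyIsotropic f (U ⊔ F ∙ v) := by
    intro x hx y hy
    obtain ⟨x₁, hx₁, x₂, hx₂, rfl⟩ := Submodule.mem_sup.1 hx
    obtain ⟨y₁, hy₁, y₂, hy₂, rfl⟩ := Submodule.mem_sup.1 hy
    obtain ⟨a, rfl⟩ := Submodule.mem_span_singleton.1 hx₂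
    obtain ⟨b, rfl⟩ := Submodule.mem_span_singleton.1 hy₂
    simp [hU.1 x₁ hx₁ y₁ hy₁, hv x₁ hx₁, hv' y₁ hy₁, hf.self_eq_zero]
  have hlt : U < U ⊔ F ∙ v := left_lt_sup.2 fun h => hvU (h (Submodule.mem_span_singleton_self v))
  exact absurd (hU.2 _ hiso) (Submodule.finrank_lt_finrank_of_lt hlt).not_ge

theorem IsMaximal.finrank_eq {f : LinearMap.BilinForm F V} {r : ℕ} (hr : 0 < r)
    (hf : IsSymplecticSpace r f) {U : Submodule F V} (hU : IsMaximal f U) :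
    Module.finrank F U = r := by
  have : FiniteDimensional F V := Module.finite_of_finrank_pos (by rw [hf.1]; omega)
  have horth : f.orthogonal U = U := le_antisymm
    (fun v hv => hU.mem_of_forall hf.2.1 hv) (fun v hv u hu => hU.1 u hu v hv)
  have h1 := LinearMap.BilinForm.finrank_orthogonal hf.2.2 U
  have h2 := Submodule.finrank_le U
  rw [horth, hf.1] at h1
  rw [hf.1] at h2
  omega

theorem sum_addChar_isMaximal [Finite F] [FiniteDimensional F V] {f : LinearMap.BilinForm F V}
    (hf : f.IsAlt) {U : Submodule F V} (hU : IsMaximal f U) [Fintype U] {χ : AddChar F ℂ}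
    (hχ : χ.IsPrimitive) (v : V) [Decidable (v ∈ U)] :
    ∑ u : U, χ (f u v) = if v ∈ U then (Fintype.card U : ℂ) else 0 := by
  split_ifs with hv
  · rw [Finset.sum_congr rfl fun u _ => by rw [hU.1 u u.2 v hv, AddChar.map_zero_eq_one]]
    simp
  · obtain ⟨u, hu, huv⟩ : ∃ u ∈ U, f u v ≠ 0 := by
      by_contra! h
      exact hv (hU.mem_of_forall hf h)
    let ψ : AddChar U ℂ :=
      χ.compAddMonoidHom ((f.flip v).comp U.subtype).toAddMonoidHom
    have hψ : ψ ≠ 0 := by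
      rw [AddChar.ne_zero_iff]
      obtain ⟨c, hc⟩ := AddChar.ne_one_iff.1 (hχ huv)
      refine ⟨⟨c • u, U.smul_mem c hu⟩, ?_⟩
      simpa [ψ, mul_comm c] using hc
    exact AddChar.sum_eq_zero_iff_ne_zero.2 hψ

/-- The points of a scalar-invariant set correspond to orbits of size `|F| - 1`. -/
theorem ncard_mul_card_sub_one [Finite F] [Finite V] {S : Set V} (h0 : (0 : V) ∉ S)
    {A : Set (ℙ F V)} (hA : ∀ (x : V) (hx : x ≠ 0), Projectivization.mk F x hx ∈ A ↔ x ∈ S) :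
    A.ncard * (Nat.card F - 1) = S.ncard := by
  rw [← Nat.card_units, ← Nat.card_coe_set_eq, ← Nat.card_coe_set_eq, ← Nat.card_prod]
  have hne : ∀ x ∈ S, x ≠ 0 := fun x hx h => h0 (h ▸ hx)
  have hrep : ∀ (P : A) (c : Fˣ), c • (P : ℙ F V).rep ∈ S := fun P c => by
    have hc : c • (P : ℙ F V).rep ≠ 0 := smul_ne_zero c.ne_zero P.1.rep_nonzero
    rw [← hA _ hc]
    convert! P.2
    conv_rhs => rw [← P.1.mk_rep]
    exact (Projectivization.mk_eq_mk_iff F _ _ _ _).2 ⟨c, rfl⟩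
  refine Nat.card_congr (Equiv.ofBijective
    (fun z : A × Fˣ => (⟨z.2 • (z.1 : ℙ F V).rep, hrep z.1 z.2⟩ : S)) ⟨?_, ?_⟩)
  · rintro ⟨P, c⟩ ⟨Q, d⟩ h
    have h : c • (P : ℙ F V).rep = d • (Q : ℙ F V).rep := congrArg Subtype.val h
    have hPQ : P = Q := by
      refine Subtype.ext ?_
      rw [← P.1.mk_rep, ← Q.1.mk_rep]
      exact (Projectivization.mk_eq_mk_iff F _ _ _ _).2 ⟨c⁻¹ * d, by rw [mul_smul, ← h, inv_smul_smul]⟩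
    subst hPQ
    refine Prod.ext rfl (Units.ext ?_)
    exact smul_left_injective F P.1.rep_nonzero h
  · rintro ⟨x, hx⟩
    have hx0 := hne x hx
    obtain ⟨c, hc⟩ := Projectivization.exists_smul_eq_mk_rep F x hx0
    exact ⟨(⟨Projectivization.mk F x hx0, (hA x hx0).2 hx⟩, c⁻¹),
      Subtype.ext (by simp only; rw [← hc, inv_smul_smul])⟩

end Ovoid

/-! ### The double count over a maximal. -/

section Core

theorem succ_mul_card_filter_isMaximal {F : Type*} [Field F] [Finite F] {K : Type*} [Field K]
    [Fintype K] [DecidableEq K] [Algebra F K] {V : Type*} [AddCommGroup V] [Module F V]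
    {p : ℕ} [Fact p.Prime] [CharP F p] [CharP K p] {ℓ M k r : ℕ}
    (hp : 2 < p) (hℓ : 0 < ℓ) (hr : 0 < r) (hF : Nat.card F ^ r = p ^ k)
    (hq : Fintype.card K = (p ^ k) ^ 2) (hR : p ^ ℓ + 1 ∣ p ^ k - 1) (hk : 1 < p ^ k)
    (hM : (p ^ ℓ + 1) * M = Fintype.card K - 1) (hM0 : 0 < M) (hM2 : 2 * (p ^ ℓ - 1) ∣ M)
    {γ δ : Kˣ} (hδ : δ * γ⁻¹ ∈ powers Kˣ (p ^ ℓ + 1)) {D : Finset Kˣ}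
    (hD : ∀ x z : Kˣ, x * z ^ (p ^ ℓ + 1) ∈ D ↔ x ∈ D)
    (hDinv : ∀ x : Kˣ, (γ * x)⁻¹ ∈ D ↔ x ∈ D)
    {f : LinearMap.BilinForm F V} (hf : IsSymplecticSpace r f) (φ : K ≃ₗ[F] V)
    (hφ : ∀ x y, f (φ x) (φ y) = Algebra.trace F K (x * (δ * y ^ p ^ k)))
    {U : Submodule F V} (hU : IsMaximal f U) [DecidablePred fun v : V => v ∈ U] :
    (p ^ k + 1) * (D.filter fun x : Kˣ => φ (x : K) ∈ U).card = D.card := by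
  classical
  have : Fintype V := Fintype.ofEquiv K φ.toEquiv
  have hUcard : Fintype.card U = p ^ k := by
    rw [← Nat.card_eq_fintype_card, Module.natCard_eq_pow_finrank (K := F), hU.finrank_eq hr hf, hF]
  obtain ⟨χ, hχ, hfrob⟩ := exists_traceChar F K p
  set D' := D.filter fun x : Kˣ => φ (x : K) ∈ U
  set q : ℂ := (Fintype.card K : ℂ) with hqdef
  set R : ℂ := ((p ^ k : ℕ) : ℂ) with hRdef
  -- The character formula covers only u ≠ 0; the last term corrects u = 0, where the sum is |D|.
  have hinner : ∀ u : U, (q - 1) * ∑ x ∈ D, χ (f u (φ (x : K))) =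
      D.card * (R - 1) - R * (q - 1) * (if ∃ a ∈ D, φ a = (u : V) then 1 else 0) +
        if u = 0 then D.card * (q - R) else 0 := by
    intro u
    by_cases hu : u = 0
    · subst hu
      have : ¬ ∃ a ∈ D, φ (a : K) = ((0 : U) : V) := by
        rintro ⟨a, -, ha⟩
        exact a.ne_zero (φ.map_eq_zero_iff.1 ha)
      rw [if_neg this, if_pos rfl]
      simp
      ring
    · have hu0 : φ.symm u ≠ 0 := by simpa using hu
      have h := sum_addChar_mul_pow (isPrimitive_comp_trace (L := K) hχ) hfrob hp hℓ hq hR hM hM0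
        hM2 hδ hD hDinv (Units.mk0 _ hu0)
      rw [if_neg hu, add_zero]
      have hiff : (∃ a ∈ D, φ (a : K) = (u : V)) ↔ Units.mk0 _ hu0 ∈ D := by
        refine ⟨fun ⟨a, ha, hau⟩ => ?_, fun ha => ⟨_, ha, by simp⟩⟩
        convert ha
        exact Units.ext (by simp [← hau])
      simp only [hiff]
      rw [← h]
      congr 1
      refine Finset.sum_congr rfl fun x _ => ?_
      have : f u (φ (x : K)) = f (φ (φ.symm u)) (φ x) := by rw [φ.apply_symm_apply]
      rw [this, hφ]
      simp only [AddChar.compAddMonoidHom_apply, LinearMap.toAddMonoidHom_coe, Units.val_mk0]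
      congr 2
      ring
  have hcount : ∑ u : U, (if ∃ a ∈ D, φ (a : K) = (u : V) then (1 : ℂ) else 0) = D'.card := by
    rw [Finset.sum_boole]
    congr 1
    refine (Finset.card_bij (s := D') (fun (x : Kˣ) hx => (⟨φ (x : K), (Finset.mem_filter.1 hx).2⟩ : U))
      (fun x hx => ?_) (fun x _ y _ h => ?_) fun u hu => ?_).symm
    · exact Finset.mem_filter.2 ⟨Finset.mem_univ _, x, (Finset.mem_filter.1 hx).1, rfl⟩
    · exact Units.ext (φ.injective (congrArg Subtype.val h))
    · obtain ⟨a, ha, hau⟩ := (Finset.mem_filter.1 hu).2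
      exact ⟨a, Finset.mem_filter.2 ⟨ha, hau ▸ u.2⟩, Subtype.ext hau⟩
  have hfin : FiniteDimensional F V := Module.Finite.of_finite
  have houter : ∑ u : U, ∑ x ∈ D, χ (f u (φ (x : K))) = R * D'.card := by
    rw [Finset.sum_comm]
    simp_rw [sum_addChar_isMaximal hf.2.1 hU hχ]
    rw [← Finset.sum_filter, Finset.sum_const, hUcard, nsmul_eq_mul, mul_comm]
  have key : (q - 1) * (R * D'.card) =
      R * (D.card * (R - 1)) - R * (q - 1) * D'.card + D.card * (q - R) := by
    rw [← houter, Finset.mul_sum, Finset.sum_congr rfl fun u _ => hinner u,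
      Finset.sum_add_distrib, Finset.sum_sub_distrib, ← Finset.mul_sum Finset.univ _ (R * (q - 1)),
      hcount]
    simp [hUcard, hRdef]
  have hqR : q = R ^ 2 := by rw [hqdef, hq, hRdef]; push_cast; ring
  have hR0 : R ≠ 0 := Nat.cast_ne_zero.2 (by omega)
  have hR1 : R - 1 ≠ 0 := sub_ne_zero.2 (Nat.cast_ne_one.2 (by omega))
  have hfinal : (R + 1) * D'.card = D.card := by
    refine mul_left_cancel₀ (mul_ne_zero (mul_ne_zero two_ne_zero hR0) hR1) ?_
    rw [hqR] at key
    linear_combination key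
  rw [hRdef] at hfinal
  exact_mod_cast hfinal

end Core

/-! ### The exponents defining D. -/

section IndexSet

/-- The residues modulo `2 d` that are at most `b - 1` together with their images under
`n ↦ -1 - n`. -/
def symmetricIndex (d b n : ℤ) : Prop := n % (2 * d) < b ∨ (-1 - n) % (2 * d) < b

theorem symmetricIndex_congr {d b n n' : ℤ} (h : 2 * d ∣ n - n') :
    symmetricIndex d b n ↔ symmetricIndex d b n' := by
  have h1 : n % (2 * d) = n' % (2 * d) :=
    Int.emod_eq_emod_iff_emod_sub_eq_zero.2 (Int.emod_eq_zero_of_dvd h)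
  have h2 : (-1 - n) % (2 * d) = (-1 - n') % (2 * d) := (Int.emod_sub_cancel_left (-1)).2 h1
  rw [symmetricIndex, symmetricIndex, h1, h2]

theorem symmetricIndex_neg {d b n : ℤ} :
    symmetricIndex d b (-1 - n) ↔ symmetricIndex d b n := by
  rw [symmetricIndex, symmetricIndex, or_comm, show -1 - (-1 - n) = n by ring]

theorem symmetricIndex_iff {d b n : ℤ} (h0 : 0 ≤ n) (h1 : n < 2 * d) :
    symmetricIndex d b n ↔ n < b ∨ 2 * d - 1 - n < b := by
  have h2 : (-1 - n) % (2 * d) = 2 * d - 1 - n := by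
    rw [← Int.add_emod_right]
    rw [Int.emod_eq_of_lt (by omega) (by omega)]
    ring
  rw [symmetricIndex, h2, Int.emod_eq_of_lt h0 h1]

open Classical in
theorem card_filter_symmetricIndex {d b : ℕ} (hb : b ≤ d) (m : ℕ) :
    ((Finset.range (2 * d * m)).filter fun n : ℕ => symmetricIndex d b n).card = 2 * b * m := by
  induction m with
  | zero => simp
  | succ m ih =>
    rw [← Nat.count_eq_card_filter_range] at ih ⊢
    rw [mul_add, Nat.count_add, ih, mul_one, mul_add, mul_one]
    congr 1
    have : ∀ n : ℕ, symmetricIndex d b ((2 * d * m + n : ℕ) : ℤ) ↔ symmetricIndex d b n :=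
      fun n => symmetricIndex_congr ⟨m, by push_cast; ring⟩
    simp only [this]
    rw [Nat.count_eq_card_filter_range]
    -- In one period the reflection is n ↦ 2d - 1 - n; the lowest b and highest b residues are
    -- disjoint because b ≤ d.
    have h2 : ((Finset.range (2 * d)).filter fun n : ℕ => symmetricIndex d b n) =
        Finset.range b ∪ Finset.Ico (2 * d - b) (2 * d) := by
      ext n
      simp only [Finset.mem_filter, Finset.mem_range, Finset.mem_union, Finset.mem_Ico]
      constructor
      · rintro ⟨h, h'⟩
        rw [symmetricIndex_iff (by omega) (by omega)] at h'
        omega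
      · intro h
        refine ⟨by omega, ?_⟩
        rw [symmetricIndex_iff (by omega) (by omega)]
        omega
    rw [h2, Finset.card_union_of_disjoint, Finset.card_range, Nat.card_Ico]
    · omega
    · rw [Finset.disjoint_left]
      intro n
      simp only [Finset.mem_range, Finset.mem_Ico]
      omega

end IndexSet

/-! ### Divisibility from the parity of t. -/

section Arithmetic

theorem two_mul_succ_dvd {θ t : ℕ} (hθ : Odd θ) (ht : Even t) : 2 * (θ + 1) ∣ θ ^ t - 1 := by
  obtain ⟨m, rfl⟩ := ht
  have h1 : θ ^ 2 - 1 ∣ θ ^ (m + m) - 1 := by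
    rw [← two_mul, pow_mul]
    simpa using Nat.sub_dvd_pow_sub_pow (θ ^ 2) 1 m
  refine Dvd.dvd.trans ?_ h1
  have := Nat.sq_sub_sq θ 1
  rw [one_pow] at this
  rw [this, mul_comm]
  exact Nat.mul_dvd_mul_left _ (hθ.tsub_odd odd_one).two_dvd

theorem exists_cofactor {θ t : ℕ} (hθ : Odd θ) (hθ1 : 1 < θ) (ht : Even t) (ht0 : 0 < t) :
    ∃ M, (θ + 1) * M = (θ ^ t) ^ 2 - 1 ∧ 0 < M ∧ 2 * (θ - 1) ∣ M := by
  obtain ⟨m, rfl⟩ := ht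
  have h1 : θ ^ 2 - 1 ∣ θ ^ (m + m) - 1 := by
    rw [← two_mul, pow_mul]
    simpa using Nat.sub_dvd_pow_sub_pow (θ ^ 2) 1 m
  have h2 := Nat.sq_sub_sq θ 1
  have h3 := Nat.sq_sub_sq (θ ^ (m + m)) 1
  rw [one_pow] at h2 h3
  rw [h2] at h1
  obtain ⟨j, hj⟩ := h1
  obtain ⟨i, hi⟩ := ((hθ.pow (n := m + m)).add_odd odd_one).two_dvd
  have hM : (θ + 1) * (2 * (θ - 1) * (j * i)) = (θ ^ (m + m)) ^ 2 - 1 := by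
    rw [h3, hi, hj]; ring
  refine ⟨_, hM, ?_, dvd_mul_right _ _⟩
  rw [Nat.pos_iff_ne_zero]
  intro h0
  rw [h0, mul_zero] at hM
  have h4 : 1 < (θ ^ (m + m)) ^ 2 := Nat.one_lt_pow two_ne_zero (Nat.one_lt_pow ht0.ne' hθ1)
  omega

end Arithmetic

/-! ### The trace model. -/

section Model

variable {F : Type u} [Field F] [Fintype F] {K : Type w} [Field K] [Algebra F K]

/-- Since δ^R = -δ, the R-th power negates δ x^(R + 1) but preserves its trace, which therefore
vanishes in odd characteristic. -/
theorem isSymplecticSpace_modelForm {p e r : ℕ} (hp : p.Prime) (hp2 : p ≠ 2) (he : 0 < e)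
    (hr : 0 < r) (hF : Fintype.card F = p ^ e) (hK : Nat.card K = p ^ (2 * e * r)) {γ : Kˣ}
    (hγ : ∀ x : Kˣ, x ∈ Subgroup.zpowers γ) :
    IsSymplecticSpace r (modelForm F r ((γ : K) ^ ((p ^ (e * r) + 1) / 2))) := by
  have hpo : Odd p := hp.odd_of_ne_two hp2
  have : Finite K := Nat.finite_of_card_ne_zero (hK ▸ pow_ne_zero _ hp.ne_zero)
  have := Fintype.ofFinite K
  set R := p ^ (e * r) with hRdef
  have hFR : Fintype.card F ^ r = R := by rw [hF, ← pow_mul]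
  have hKR : Nat.card K = R ^ 2 := by rw [hK, hRdef, ← pow_mul]; ring_nf
  have hRo : Odd R := hpo.pow
  have hR1 : 1 < R := Nat.one_lt_pow (by positivity) hp.one_lt
  have hfin : Module.finrank F K = 2 * r := by
    have h := Module.natCard_eq_pow_finrank (K := F) (V := K)
    rw [hK, Nat.card_eq_fintype_card, hF, ← pow_mul, mul_comm 2, mul_assoc] at h
    exact (Nat.eq_of_mul_eq_mul_left he (Nat.pow_right_injective hp.two_le h)).symm
  set δ : K := (γ : K) ^ ((R + 1) / 2) with hδ
  have hord : orderOf γ = R ^ 2 - 1 := by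
    rw [orderOf_eq_card_of_forall_mem_zpowers hγ, Nat.card_units, hKR]
  have hδ0 : δ ≠ 0 := pow_ne_zero _ γ.ne_zero
  have hδR : δ ^ R = -δ := by
    obtain ⟨a, ha⟩ := hRo
    have hR2 : R ^ 2 - 1 = 2 * (a * (R + 1)) := by
      have := Nat.sq_sub_sq R 1
      rw [one_pow] at this
      rw [this, show R - 1 = 2 * a by omega]; ring
    have h1 : (γ : K) ^ (a * (R + 1)) = -1 := by
      have h2 : ((γ : K) ^ (a * (R + 1))) ^ 2 = 1 := by
        rw [← pow_mul, mul_comm _ 2, ← hR2, ← hord]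
        rw [← Units.val_pow_eq_pow_val, pow_orderOf_eq_one, Units.val_one]
      refine (sq_eq_sq_iff_eq_or_eq_neg.1 (h2.trans (one_pow 2).symm)).resolve_left ?_
      intro h3
      have h4 := orderOf_dvd_of_pow_eq_one (x := γ) (Units.ext (by simpa using h3))
      have ha0 : 0 < a * (R + 1) := Nat.mul_pos (by omega) (by omega)
      rw [hord, hR2] at h4
      have := Nat.le_of_dvd ha0 h4
      omega
    have h5 : δ ^ (R - 1) = -1 := by
      rw [hδ, ← pow_mul, ← h1]
      congr 1
      rw [show R - 1 = 2 * a by omega, show (R + 1) / 2 = a + 1 by omega,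
        show R + 1 = 2 * (a + 1) by omega]
      ring
    conv_lhs => rw [← Nat.sub_add_cancel hR1.le, pow_succ, h5, neg_one_mul]
  have hbij : Function.Bijective fun y : K => y ^ R := by
    have h := AlgHom.bijective ((FiniteField.frobeniusAlgHom F K) ^ r)
    simpa [AlgHom.coe_pow, FiniteField.coe_frobeniusAlgHom, pow_iterate, hFR] using h
  have htr : ∀ z : K, Algebra.trace F K (z ^ R) = Algebra.trace F K z := fun z => by
    have h := Algebra.trace_eq_of_algEquiv
      (AlgEquiv.ofBijective _ (AlgHom.bijective ((FiniteField.frobeniusAlgHom F K) ^ r))) z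
    simpa [AlgHom.coe_pow, FiniteField.coe_frobeniusAlgHom, pow_iterate, hFR] using h
  have halt : (modelForm F r δ).IsAlt := fun x => by
    rw [modelForm_apply, hFR]
    have h1 : (x * (δ * x ^ R)) ^ R = -(x * (δ * x ^ R)) := by
      have hq : (x ^ R) ^ R = x := by
        rw [← pow_mul, ← sq, ← hKR, Nat.card_eq_fintype_card, FiniteField.pow_card]
      rw [mul_pow, mul_pow, hδR, hq]; ring
    have h2 := htr (x * (δ * x ^ R))
    rw [h1, map_neg] at h2
    have hF2 : (2 : F) ≠ 0 := Ring.two_ne_zero (by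
      rw [Ne, FiniteField.even_card_iff_char_two, hF]
      have := hpo.pow (n := e)
      rw [Nat.odd_iff] at this
      omega)
    have h3 : 2 * Algebra.trace F K (x * (δ * x ^ R)) = 0 := by linear_combination -h2
    exact (mul_eq_zero.1 h3).resolve_left hF2
  have hleft : (modelForm F r δ).SeparatingLeft := fun x hx => by
    refine (traceForm_nondegenerate F K).1 x fun y => ?_
    obtain ⟨z, hz⟩ := hbij.2 (δ⁻¹ * y)
    simp only at hz
    have := hx z
    rw [modelForm_apply, hFR, hz, mul_inv_cancel_left₀ hδ0] at this
    exact this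
  refine ⟨hfin, halt, hleft, fun y hy => hleft y fun x => ?_⟩
  rw [← halt.neg_eq, hy, neg_zero]

end Model
-- Construction of the ovoids.
section Construction

variable {F : Type u} [Field F] [Fintype F] {K : Type w} [Field K] [Algebra F K]
  {V : Type v} [AddCommGroup V] [Module F V]

theorem zpow_mem_cyclotomicUnion_iff [Finite K] {γ : Kˣ} (hγ : ∀ x : Kˣ, x ∈ Subgroup.zpowers γ)
    {N : ℕ} (hN : N ∣ Nat.card K - 1) (hN0 : 0 < N) {P : ℤ → Prop}
    (hP : ∀ n n' : ℤ, (N : ℤ) ∣ n - n' → (P n ↔ P n')) (n : ℤ) :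
    ((γ ^ n : Kˣ) : K) ∈ cyclotomicUnion γ N {i | P (i : ℕ)} ↔ P n := by
  have hord : orderOf γ = Nat.card K - 1 := by
    rw [orderOf_eq_card_of_forall_mem_zpowers hγ, Nat.card_units]
  have hcard : 0 < Nat.card K - 1 := hord ▸ orderOf_pos γ
  simp only [cyclotomicUnion, cyclotomicClass, Set.mem_iUnion, Set.mem_ofPred_eq, exists_prop]
  constructor
  · rintro ⟨i, hi, j, hj, h⟩
    have h' : γ ^ n = γ ^ ((j * N + i : ℕ) : ℤ) := Units.ext (by
      rw [h, zpow_natCast, Units.val_pow_eq_pow_val])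
    have h1 : (N : ℤ) ∣ n - ((j * N + i : ℕ) : ℤ) := by
      have h2 := (zpow_eq_zpow_iff_modEq.1 h').symm.dvd
      exact (Int.natCast_dvd_natCast.2 (hord ▸ hN)).trans h2
    refine (hP n i ?_).2 hi
    have h3 : n - (i : ℕ) = (n - ((j * N + i : ℕ) : ℤ)) + j * N := by push_cast; ring
    rw [h3]
    exact dvd_add h1 (dvd_mul_left _ _)
  · intro h
    obtain ⟨m, hm⟩ := Int.eq_ofNat_of_zero_le
      (Int.emod_nonneg n (b := (Nat.card K - 1 : ℕ)) (by omega))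
    have hmlt : m < Nat.card K - 1 := by
      have := Int.emod_lt_of_pos n (b := (Nat.card K - 1 : ℕ)) (by omega)
      omega
    have hnm : γ ^ n = γ ^ m := by
      rw [← zpow_natCast, zpow_eq_zpow_iff_modEq, hord]
      change n % _ = m % _
      rw [← hm, Int.emod_emod_of_dvd _ dvd_rfl]
    have hdvd : (N : ℤ) ∣ n - m := by
      have h2 : ((Nat.card K - 1 : ℕ) : ℤ) ∣ n - m := hm ▸ Int.dvd_self_sub_emod
      exact (Int.natCast_dvd_natCast.2 hN).trans h2
    refine ⟨⟨m % N, Nat.mod_lt _ hN0⟩, ?_, m / N, ?_, ?_⟩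
    · refine (hP n (m % N : ℕ) ?_).1 h
      have h3 : n - (m % N : ℕ) = (n - m) + N * (m / N : ℕ) := by
        have : (m : ℤ) = N * (m / N : ℕ) + (m % N : ℕ) := by
          exact_mod_cast (Nat.div_add_mod m N).symm
        rw [this]
        push_cast
        ring_nf
      rw [h3]
      exact dvd_add hdvd (dvd_mul_right _ _)
    · exact Nat.div_lt_div_of_lt_of_dvd hN hmlt
    · rw [hnm, Nat.mul_comm, Nat.div_add_mod]
      simp

open Classical in
theorem card_filter_zpow {G : Type*} [Group G] [Fintype G] {γ : G}
    (hγ : ∀ x : G, x ∈ Subgroup.zpowers γ) {P : ℤ → Prop} {Q : G → Prop}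
    (hQ : ∀ n : ℤ, Q (γ ^ n) ↔ P n) :
    (Finset.univ.filter Q).card =
      ((Finset.range (Nat.card G)).filter fun n : ℕ => P n).card := by
  have hord := orderOf_eq_card_of_forall_mem_zpowers hγ
  rw [← hord, ← IsCyclic.image_range_orderOf hγ, Finset.filter_image, Finset.card_image_of_injOn]
  · congr 1
    exact Finset.filter_congr fun n _ => by rw [← hQ, zpow_natCast]
  · intro x hx y hy h
    exact pow_injOn_Iio_orderOf (Finset.mem_range.1 (Finset.mem_filter.1 hx).1)
      (Finset.mem_range.1 (Finset.mem_filter.1 hy).1) h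

/-- Keeping the isometry φ as a parameter serves both an arbitrary model and, with φ the identity,
the trace model itself. -/
theorem exists_isMOvoid {p e r ℓ t : ℕ} (hp : p.Prime) (hp2 : p ≠ 2)
    (he : 0 < e) (hr : 0 < r) (hℓ : 0 < ℓ) (ht : 0 < t) (hs : e * r = ℓ * t)
    (hteven : Even t) (hF : Fintype.card F = p ^ e)
    (hK : Nat.card K = p ^ (2 * e * r)) {γ : Kˣ} (hγ : ∀ x : Kˣ, x ∈ Subgroup.zpowers γ)
    {f : LinearMap.BilinForm F V} (hf : IsSymplecticSpace r f) (φ : K ≃ₗ[F] V)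
    (hφ : ∀ x y, f (φ x) (φ y) = modelForm F r ((γ : K) ^ ((p ^ (e * r) + 1) / 2)) x y)
    {b : ℕ} (hb : 1 ≤ b) (hbd : b ≤ d₀ p e r ℓ - 1) :
    ∃ (m : ℕ) (M : Set (ℙ F V)) (J : Set (Fin (p ^ ℓ + 1))),
      m * (d₀ p e r ℓ * (p ^ e - 1)) = b * (p ^ (e * r) - 1) ∧ IsMOvoid f m M ∧
      (∀ (x : K) (hx : x ≠ 0), Projectivization.mk F (φ x) (φ.map_ne_zero_iff.2 hx) ∈ M ↔
        x ∈ cyclotomicUnion γ (p ^ ℓ + 1) J) ∧ M.Nonempty ∧ M ≠ Set.univ := by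
  classical
  have : Fact p.Prime := ⟨hp⟩
  have hpo : Odd p := hp.odd_of_ne_two hp2
  have hp3 : 2 < p := lt_of_le_of_ne hp.two_le (Ne.symm hp2)
  have : Finite K := Nat.finite_of_card_ne_zero (hK ▸ pow_ne_zero _ hp.ne_zero)
  have := Fintype.ofFinite K
  have : Finite V := Finite.of_equiv K φ.toEquiv
  have : CharP F p := charP_of_card_eq_prime_pow hF
  have : CharP K p := charP_of_injective_algebraMap (algebraMap F K).injective p
  set d := d₀ p e r ℓ with hd
  set N := p ^ ℓ + 1 with hN
  set R := p ^ (e * r) with hRdef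
  set A := ∑ i ∈ Finset.range r, (p ^ e) ^ i with hA
  have hN0 : 0 < N := Nat.succ_pos _
  have hFR : Fintype.card F ^ r = R := by rw [hF, ← pow_mul]
  have hKR : Nat.card K = R ^ 2 := by rw [hK, hRdef, ← pow_mul]; ring_nf
  have hqR : Fintype.card K = R ^ 2 := by rw [← Nat.card_eq_fintype_card, hKR]
  have hR1 : 1 < R := Nat.one_lt_pow (by positivity) hp.one_lt
  have hq1 : R ^ 2 - 1 = (R + 1) * (R - 1) := by
    have := Nat.sq_sub_sq R 1
    rwa [one_pow] at this
  have hpe : 1 < p ^ e := Nat.one_lt_pow he.ne' hp.one_lt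
  have hRA : A * (p ^ e - 1) = R - 1 := by
    rw [hA, Nat.geomSum_eq hpe, hRdef, pow_mul]
    exact Nat.div_mul_cancel (by simpa using Nat.sub_dvd_pow_sub_pow (p ^ e) 1 r)
  have hdA : d ∣ A := by rw [hd, d₀_eq hp.two_le he]; exact Nat.gcd_dvd_right _ _
  have hdN : 2 * d ∣ N := two_mul_d₀_dvd hpo e r ℓ
  have hRθ : R = (p ^ ℓ) ^ t := by rw [hRdef, hs, pow_mul]
  have h2N : 2 * N ∣ R - 1 := hRθ ▸ two_mul_succ_dvd hpo.pow hteven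
  have hNR : N ∣ R - 1 := (dvd_mul_left _ _).trans h2N
  have hNq : N ∣ R ^ 2 - 1 := hq1 ▸ hNR.mul_left _
  obtain ⟨M₀, hM₀, hM₀pos, hM₀2⟩ := exists_cofactor (hpo.pow (n := ℓ))
    (Nat.one_lt_pow hℓ.ne' hp.one_lt) hteven ht
  rw [← hRθ, ← hqR] at hM₀
  have hord : orderOf γ = R ^ 2 - 1 := by
    rw [orderOf_eq_card_of_forall_mem_zpowers hγ, Nat.card_units, hKR]
  have hcongr : ∀ n n' : ℤ, (N : ℤ) ∣ n - n' → (symmetricIndex d b n ↔ symmetricIndex d b n') :=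
    fun n n' h => symmetricIndex_congr
      (by exact_mod_cast (Int.natCast_dvd_natCast.2 hdN).trans h)
  set J : Set (Fin N) := {i | symmetricIndex d b (i : ℕ)} with hJ
  set S : Set K := cyclotomicUnion γ N J with hS
  have hmemS : ∀ n : ℤ, ((γ ^ n : Kˣ) : K) ∈ S ↔ symmetricIndex d b n := fun n =>
    zpow_mem_cyclotomicUnion_iff hγ (hKR ▸ hNq) hN0 hcongr n
  have h0S : (0 : K) ∉ S := by
    simp only [hS, cyclotomicUnion, cyclotomicClass, Set.mem_iUnion, Set.mem_ofPred_eq, not_exists]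
    rintro i - j ⟨-, h⟩
    exact pow_ne_zero _ γ.ne_zero h.symm
  have hscale : ∀ (c : F) (x : K), c ≠ 0 → (c • x ∈ S ↔ x ∈ S) := by
    intro c x hc
    by_cases hx : x = 0
    · simp [hx]
    obtain ⟨n, hn⟩ := Subgroup.mem_zpowers_iff.1 (hγ (Units.mk0 x hx))
    obtain ⟨k, hk⟩ := Subgroup.mem_zpowers_iff.1
      (hγ (Units.mk0 (algebraMap F K c) ((map_ne_zero _).2 hc)))
    have hx' : x = ((γ ^ n : Kˣ) : K) := by rw [hn]; rfl
    have hcx : c • x = ((γ ^ (k + n) : Kˣ) : K) := by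
      rw [zpow_add, hk, hn, Algebra.smul_def]; rfl
    rw [hcx, hx', hmemS, hmemS]
    refine symmetricIndex_congr ?_
    have h1 : γ ^ (k * (p ^ e - 1 : ℕ)) = 1 := by
      rw [zpow_mul, hk, zpow_natCast]
      refine Units.ext ?_
      have := FiniteField.pow_card_sub_one_eq_one c hc
      rw [hF] at this
      simp [← map_pow, this]
    -- q - 1 = (R + 1) A (p^e - 1), with 2 ∣ R + 1 and d ∣ A, so a scalar γ^k has 2d ∣ k.
    have h2 : ((2 * d * (p ^ e - 1) : ℕ) : ℤ) ∣ k * (p ^ e - 1 : ℕ) := by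
      refine Dvd.dvd.trans ?_ (orderOf_dvd_iff_zpow_eq_one.2 h1)
      rw [hord, hq1, ← hRA, ← mul_assoc]
      exact Int.natCast_dvd_natCast.2 (Nat.mul_dvd_mul_right
        (Nat.mul_dvd_mul ((hpo.pow (n := e * r)).add_odd odd_one).two_dvd hdA) _)
    rw [Nat.cast_mul] at h2
    have h3 := Int.dvd_of_mul_dvd_mul_right (by omega) h2
    rw [show k + n - n = k by ring]
    exact_mod_cast h3
  set D : Finset Kˣ := Finset.univ.filter fun x : Kˣ => (x : K) ∈ S with hDdef
  have hmemD : ∀ n : ℤ, γ ^ n ∈ D ↔ symmetricIndex d b n := fun n => by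
    rw [hDdef, Finset.mem_filter, hmemS]; simp
  have hD : ∀ x z : Kˣ, x * z ^ N ∈ D ↔ x ∈ D := fun x z => by
    obtain ⟨n, rfl⟩ := Subgroup.mem_zpowers_iff.1 (hγ x)
    obtain ⟨k, rfl⟩ := Subgroup.mem_zpowers_iff.1 (hγ z)
    rw [← zpow_natCast, ← zpow_mul, ← zpow_add, hmemD, hmemD]
    exact hcongr _ _ ⟨k, by ring⟩
  have hDinv : ∀ x : Kˣ, (γ * x)⁻¹ ∈ D ↔ x ∈ D := fun x => by
    obtain ⟨n, rfl⟩ := Subgroup.mem_zpowers_iff.1 (hγ x)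
    rw [← zpow_one_add, ← zpow_neg, show -(1 + n) = -1 - n by ring, hmemD, hmemD,
      symmetricIndex_neg]
  have hδ : γ ^ ((R + 1) / 2) * γ⁻¹ ∈ powers Kˣ N := by
    obtain ⟨i, hi⟩ := h2N
    refine mem_powers.2 ⟨γ ^ i, ?_⟩
    rw [show (R + 1) / 2 = N * i + 1 by rw [mul_assoc] at hi; omega,
      pow_succ γ (N * i),
      mul_inv_cancel_right, ← pow_mul, mul_comm]
  obtain ⟨a, ha⟩ := hdA
  have hb' : b ≤ d := by omega
  have hd0 : 0 < d := by omega
  obtain ⟨c, hc⟩ : 2 * d ∣ R ^ 2 - 1 := hdN.trans hNq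
  have hDcard : D.card = 2 * b * c := by
    rw [hDdef, card_filter_zpow hγ hmemS, Nat.card_units, hKR, hc, card_filter_symmetricIndex hb']
  -- The choice of representative is harmless because S is closed under nonzero scalars.
  set M : Set (ℙ F V) := {P | φ.symm P.rep ∈ S} with hM
  have hmemM : ∀ (v : V) (hv : v ≠ 0), Projectivization.mk F v hv ∈ M ↔ φ.symm v ∈ S := by
    intro v hv
    obtain ⟨c, hc⟩ := Projectivization.exists_smul_eq_mk_rep F v hv
    change φ.symm (Projectivization.mk F v hv).rep ∈ S ↔ _
    rw [← hc, Units.smul_def, map_smul, hscale _ _ c.ne_zero]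
  refine ⟨b * a, M, J, ?_, ?_, fun x hx => ?_, ?_, ?_⟩
  · rw [← hRA, ha]; ring
  · intro U hU
    have hcard := ncard_mul_card_sub_one (F := F) (S := {v : V | φ.symm v ∈ S ∧ v ∈ U})
      (by simp [h0S]) (A := {P : ℙ F V | P ∈ M ∧ P.submodule ≤ U}) fun v hv => by
        simp only [Set.mem_ofPred_eq]
        rw [hmemM, Projectivization.submodule_mk, Submodule.span_singleton_le_iff_mem]
    have hncard : {v : V | φ.symm v ∈ S ∧ v ∈ U}.ncard =
        (D.filter fun x : Kˣ => φ (x : K) ∈ U).card := by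
      rw [← Set.ncard_coe_finset]
      symm
      refine Set.ncard_congr (fun x _ => φ (x : K)) (fun x hx => ?_)
        (fun x y _ _ h => Units.ext (φ.injective h)) fun v hv => ?_
      · simp only [Finset.coe_filter, hDdef, Finset.mem_filter, Set.mem_ofPred_eq] at hx
        exact ⟨by simpa using hx.1.2, hx.2⟩
      · have hv0 : φ.symm v ≠ 0 := fun h => h0S (h ▸ hv.1)
        refine ⟨Units.mk0 _ hv0, ?_, by simp⟩
        simp only [Finset.coe_filter, hDdef, Finset.mem_filter, Set.mem_ofPred_eq]
        simpa using hv
    have hcore := succ_mul_card_filter_isMaximal (M := M₀) (δ := γ ^ ((R + 1) / 2)) hp3 hℓ hr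
      (by rw [Nat.card_eq_fintype_card, hFR]) hqR hNR hR1 hM₀ hM₀pos hM₀2 hδ hD hDinv hf φ
      (fun x y => by rw [hφ, modelForm_apply, hFR, Units.val_pow_eq_pow_val]) hU
    rw [← hncard, ← hcard, hDcard, Nat.card_eq_fintype_card, hF] at hcore
    have hpos : 0 < (R + 1) * (p ^ e - 1) * d := by
      have := Nat.sub_pos_of_lt hpe
      positivity
    refine Nat.eq_of_mul_eq_mul_left hpos ?_
    have h5 : 2 * d * c = (R + 1) * (d * a * (p ^ e - 1)) := by rw [← hc, hq1, ← hRA, ha]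
    calc _ = d * ((R + 1) * ({P : ℙ F V | P ∈ M ∧ P.submodule ≤ U}.ncard * (p ^ e - 1))) := by ring
      _ = b * (2 * d * c) := by rw [hcore]; ring
      _ = _ := by rw [h5]; ring
  · rw [hmemM, φ.symm_apply_apply]
  · refine ⟨Projectivization.mk F (φ 1) (φ.map_ne_zero_iff.2 one_ne_zero), ?_⟩
    rw [hmemM, φ.symm_apply_apply]
    have := hmemS 0
    rw [zpow_zero, Units.val_one] at this
    rw [this, symmetricIndex_iff le_rfl (by omega)]
    omega
  · rw [Set.ne_univ_iff_exists_notMem]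
    -- The exponent b is omitted: b < d gives b ≤ 2d - 1 - b.
    refine ⟨Projectivization.mk F (φ ((γ ^ (b : ℤ) : Kˣ) : K))
      (φ.map_ne_zero_iff.2 (Units.ne_zero _)), ?_⟩
    rw [hmemM, φ.symm_apply_apply, hmemS, symmetricIndex_iff (by omega) (by omega)]
    omega

end Construction

end SymplecticPolar

theorem theorem3p5 (p s e r ℓ t : ℕ) (hp : p.Prime) (hp2 : p ≠ 2)
    (he : 0 < e) (hr : 0 < r) (hℓ : 0 < ℓ) (ht : 0 < t)
    (hs : s = 2 * e * r) (hs' : s = 2 * ℓ * t) (hrodd : Odd r) (hteven : Even t)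
    (F : Type u) [Field F] [Fintype F] (hF : Fintype.card F = p ^ e) :
    -- existence in every model of the symplectic polar space
    (1 < SymplecticPolar.d₀ p e r ℓ →
      ∀ (V : Type v) [AddCommGroup V] [Module F V] (f : LinearMap.BilinForm F V),
        SymplecticPolar.IsSymplecticSpace r f →
        ∀ b : ℕ, 1 ≤ b → b ≤ SymplecticPolar.d₀ p e r ℓ - 1 →
          ∃ (m : ℕ) (M : Set (ℙ F V)),
            m * (SymplecticPolar.d₀ p e r ℓ * (p ^ e - 1)) = b * (p ^ (e * r) - 1) ∧
            SymplecticPolar.IsMOvoid f m M ∧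
            (r.Prime → ¬ SymplecticPolar.ComesFromFieldReduction r f M)) ∧
    -- in the finite field model the ovoids are unions of cyclotomic classes
    (∀ (K : Type v) [Field K] [Algebra F K] (γ : Kˣ), Nat.card K = p ^ s →
      (∀ x : Kˣ, x ∈ Subgroup.zpowers γ) →
        SymplecticPolar.IsSymplecticSpace r
          (SymplecticPolar.modelForm F r ((γ : K) ^ ((p ^ (e * r) + 1) / 2))) ∧
        (1 < SymplecticPolar.d₀ p e r ℓ →
          ∀ b : ℕ, 1 ≤ b → b ≤ SymplecticPolar.d₀ p e r ℓ - 1 →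
            ∃ (m : ℕ) (M : Set (ℙ F K)) (J : Set (Fin (p ^ ℓ + 1))),
              m * (SymplecticPolar.d₀ p e r ℓ * (p ^ e - 1)) = b * (p ^ (e * r) - 1) ∧
              SymplecticPolar.IsMOvoid
                (SymplecticPolar.modelForm F r ((γ : K) ^ ((p ^ (e * r) + 1) / 2))) m M ∧
              (∀ (x : K) (hx : x ≠ 0), Projectivization.mk F x hx ∈ M ↔
                x ∈ SymplecticPolar.cyclotomicUnion γ (p ^ ℓ + 1) J) ∧
              (r.Prime → ¬ SymplecticPolar.ComesFromFieldReduction r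
                (SymplecticPolar.modelForm F r ((γ : K) ^ ((p ^ (e * r) + 1) / 2))) M))) ∧
    -- the two cases for `r` an odd prime
    (r.Prime →
      (r ∣ t →
        SymplecticPolar.d₀ p e r ℓ = Nat.gcd (p ^ ℓ + 1) r ∧
        (1 < SymplecticPolar.d₀ p e r ℓ ↔ r ∣ p ^ ℓ + 1) ∧
        (1 < SymplecticPolar.d₀ p e r ℓ ↔ SymplecticPolar.d₀ p e r ℓ = r)) ∧
      (¬ r ∣ t → 1 < SymplecticPolar.d₀ p e r ℓ)) := by
  have hs2 : e * r = ℓ * t := by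
    rw [hs, mul_assoc, mul_assoc] at hs'
    exact Nat.eq_of_mul_eq_mul_left two_pos hs'
  have hpo : Odd p := hp.odd_of_ne_two hp2
  subst hs
  refine ⟨fun h V _ _ f hf b hb hbd => ?_, fun K _ _ γ hK hγ => ?_, fun hrp => ⟨fun hrt => ?_, ?_⟩⟩
  · have : Fact p.Prime := ⟨hp⟩
    have : CharP F p := charP_of_card_eq_prime_pow hF
    have : NeZero (2 * r) := ⟨by omega⟩
    have hK : Nat.card (FiniteField.Extension F p (2 * r)) = p ^ (2 * e * r) := by
      rw [FiniteField.natCard_extension, Nat.card_eq_fintype_card, hF, ← pow_mul]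
      ring_nf
    obtain ⟨γ, hγ⟩ := IsCyclic.exists_generator (α := (FiniteField.Extension F p (2 * r))ˣ)
    have hmodel := SymplecticPolar.isSymplecticSpace_modelForm hp hp2 he hr hF hK hγ
    have : FiniteDimensional F V := Module.finite_of_finrank_pos (by rw [hf.1]; omega)
    obtain ⟨φ, hφ⟩ := SymplecticPolar.exists_isometry (2 * r) hmodel.2.1 hmodel.2.2 hf.2.1 hf.2.2
      hmodel.1 hf.1
    obtain ⟨m, M, -, hm, hM, -, hne, hnu⟩ := SymplecticPolar.exists_isMOvoid hp hp2 he hr hℓ ht hs2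
      hteven hF hK hγ hf φ hφ hb hbd
    exact ⟨m, M, hm, hM, fun hrp => SymplecticPolar.not_comesFromFieldReduction hrp hf hne hnu⟩
  · have hmodel := SymplecticPolar.isSymplecticSpace_modelForm hp hp2 he hr hF hK hγ
    refine ⟨hmodel, fun h b hb hbd => ?_⟩
    obtain ⟨m, M, J, hm, hM, hJ, hne, hnu⟩ := SymplecticPolar.exists_isMOvoid hp hp2 he hr hℓ ht hs2
      hteven hF hK hγ hmodel (LinearEquiv.refl F K) (fun _ _ => rfl) hb hbd
    exact ⟨m, M, J, hm, hM, hJ,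
      fun hrp => SymplecticPolar.not_comesFromFieldReduction hrp hmodel hne hnu⟩
  · have hd := SymplecticPolar.d₀_eq_gcd hp.two_le hpo he hr hs2 hrodd hteven hrt
    have hiff : Nat.gcd (p ^ ℓ + 1) r = r ↔ r ∣ p ^ ℓ + 1 := Nat.gcd_eq_right_iff_dvd
    have hlt : 1 < Nat.gcd (p ^ ℓ + 1) r ↔ Nat.gcd (p ^ ℓ + 1) r = r :=
      ⟨fun h => ((Nat.dvd_prime hrp).1 (Nat.gcd_dvd_right _ _)).resolve_left h.ne',
        fun h => by rw [h]; exact hrp.one_lt⟩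
    rw [hd]
    exact ⟨rfl, hlt.trans hiff, hlt⟩
  · exact SymplecticPolar.one_lt_d₀ hp.two_le hpo he hℓ hs2 hrp hrodd hteven
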